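/- A partial linear space is a pair $\Pi=(P,\mathcal L)$ of a non-empty set $P$ of points and a family $\mathcal L$ of proper subsets of $P$ (lines) such that every line has at least two points, every point lies on a line, and two distinct points lie on at most one common line; two points are collinear if some line contains both (in particular every point is collinear to itself). A subspace is a set of points containing every line that joins two of its distinct collinear points; $\langle X\rangle$ denotes the smallest subspace containing $X$; a subspace is singular if its points are mutually collinear, and it has dimension $k$ if it is spanned by an independent set of $k+1$ points. A polar space is a partial linear space in which (P1) every line has at least three points, (P2) no point is collinear to all points, (P3) for every point and every line the point is collinear to exactly one or to all points of the line, (P4) every chain of singular subspaces is finite; it has rank $n$ if all its maximal singular subspaces have dimension $n-1$. A thin polar space of rank $n\ge 2$ is a partial linear space isomorphic to the one with point set $\{\pm1,\dots,\pm n\}$ whose lines are the two-element subsets $\{i,j\}$ with $j\ne -i$. For $k\le n-2$, $\Gamma_k(\Pi)$ is the graph whose vertices are the $k$-dimensional singular subspaces of $\Pi$, two distinct ones being adjacent if some $(k+1)$-dimensional singular subspace contains both. An isometric embedding of graphs is an injection of the vertex sets that preserves adjacency, non-adjacency and the path distance. **Theorem.** Let $\Pi=(P,\mathcal L)$ be a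 polar space or a thin polar space of rank $n$, and let $\Pi'=(P',\mathcal L')$ be a polar space of the same rank $n$. Then every isometric embedding $f$ of $\Gamma_{n-2}(\Pi)$ in $\Gamma_{n-2}(\Pi')$ is induced by a collinearity preserving injection of $\Pi$ to $\Pi'$: there is an injection $\varphi:P\to P'$ sending collinear points to collinear points and non-collinear points to non-collinear points such that $f(S)=\langle\varphi(S)\rangle$ for every $(n-2)$-dimensional singular subspace $S$ of $\Pi$. -/

import Mathlib

universe u v

/-- A partial linear space with point set `P`; lines are sets of points. -/
structure PartialLinearSpace (P : Type u) where
  /-- The family of lines. -/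
  lines : Set (Set P)
  nonempty : Nonempty P
  line_proper : ∀ L ∈ lines, L ≠ Set.univ
  line_nontrivial : ∀ L ∈ lines, L.Nontrivial
  exists_line : ∀ p : P, ∃ L ∈ lines, p ∈ L
  line_unique : ∀ p q : P, p ≠ q → ∀ L ∈ lines, ∀ M ∈ lines,
    p ∈ L → q ∈ L → p ∈ M → q ∈ M → L = M

namespace PartialLinearSpace

variable {P : Type u} {P' : Type v}

/-- Two points are collinear if some line contains both. Every point lies on a line, so every
point is collinear to itself. -/
def Coll (Q : PartialLinearSpace P) (p q : P) : Prop :=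
  ∃ L ∈ Q.lines, p ∈ L ∧ q ∈ L

/-- A subspace contains the line joining any two of its distinct collinear points. -/
def IsSubspace (Q : PartialLinearSpace P) (S : Set P) : Prop :=
  ∀ p ∈ S, ∀ q ∈ S, p ≠ q → ∀ L ∈ Q.lines, p ∈ L → q ∈ L → L ⊆ S

/-- A singular subspace: a subspace whose points are mutually collinear. -/
def IsSingular (Q : PartialLinearSpace P) (S : Set P) : Prop :=
  Q.IsSubspace S ∧ ∀ p ∈ S, ∀ q ∈ S, Q.Coll p q

/-- The subspace spanned by `X`: the smallest subspace containing `X`. -/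
def span (Q : PartialLinearSpace P) (X : Set P) : Set P :=
  ⋂₀ {S | Q.IsSubspace S ∧ X ⊆ S}

/-- `X` is independent if no point of `X` lies in the subspace spanned by the other points. -/
def Indep (Q : PartialLinearSpace P) (X : Set P) : Prop :=
  ∀ x ∈ X, x ∉ Q.span (X \ {x})

/-- Projective dimension: `S` is `k`-dimensional if it has a basis (an independent spanning set)
of `k + 1` points. The empty set has dimension `-1`, a point `0`, a line `1`. -/
def HasDim (Q : PartialLinearSpace P) (S : Set P) (k : ℤ) : Prop :=
  ∃ X : Set P, X.Finite ∧ (X.ncard : ℤ) = k + 1 ∧ Q.Indep X ∧ Q.span X = S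

/-- The axioms of a polar space: every line has at least three points, no point is collinear to
all points, a point is collinear to one or all points of a line, and chains of singular subspaces
are finite. -/
structure IsPolarSpace (Q : PartialLinearSpace P) : Prop where
  three_points : ∀ L ∈ Q.lines, 3 ≤ L.encard
  no_universal_point : ¬ ∃ p, ∀ q, Q.Coll p q
  one_or_all : ∀ p, ∀ L ∈ Q.lines,
    (∃! q, q ∈ L ∧ Q.Coll p q) ∨ (∀ q ∈ L, Q.Coll p q)
  chain_finite : ∀ C : Set (Set P), (∀ S ∈ C, Q.IsSingular S) → IsChain (· ⊆ ·) C → C.Finite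

/-- A polar space of rank `n`: all maximal singular subspaces are `(n - 1)`-dimensional. -/
structure IsPolarSpaceOfRank (Q : PartialLinearSpace P) (n : ℕ) : Prop where
  isPolarSpace : Q.IsPolarSpace
  dim_maximal : ∀ M, Maximal Q.IsSingular M → Q.HasDim M ((n : ℤ) - 1)

/-- A collineation: a bijection of the point sets carrying the family of lines onto the family
of lines. -/
def IsCollineation (Q : PartialLinearSpace P) (Q' : PartialLinearSpace P') (e : P ≃ P') : Prop :=
  (fun L : Set P => e '' L) '' Q.lines = Q'.lines

/-- The standard thin polar space of rank `n ≥ 2`. The point set `{±1, …, ±n}` is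
`Fin n × Bool`, where `-(i, b) = (i, !b)`; the lines are the pairs of distinct non-opposite
points, that is, pairs of points with different first coordinates. -/
def thin (n : ℕ) (hn : 2 ≤ n) : PartialLinearSpace (Fin n × Bool) where
  lines := {L | ∃ x y : Fin n × Bool, x.1 ≠ y.1 ∧ L = {x, y}}
  nonempty := ⟨(⟨0, by omega⟩, true)⟩
  line_proper := by
    rintro L ⟨x, y, hxy, rfl⟩ h
    have h1 : ((x.1, !x.2) : Fin n × Bool) ∈ ({x, y} : Set (Fin n × Bool)) := by
      rw [h]; trivial
    rcases h1 with h1 | h1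
    · have := congrArg Prod.snd h1
      simp at this
    · rw [Set.mem_singleton_iff] at h1
      exact hxy (by rw [← h1])
  line_nontrivial := by
    rintro L ⟨x, y, hxy, rfl⟩
    exact Set.nontrivial_pair (fun h => hxy (congrArg Prod.fst h))
  exists_line := by
    intro p
    have : Nontrivial (Fin n) := Fin.nontrivial_iff_two_le.mpr hn
    obtain ⟨j, hj⟩ := exists_ne p.1
    exact ⟨{p, (j, true)}, ⟨p, (j, true), hj.symm, rfl⟩, by simp⟩
  line_unique := by
    rintro p q hpq L ⟨x, y, hxy, rfl⟩ M ⟨z, w, hzw, rfl⟩ h1 h2 h3 h4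
    simp only [Set.mem_insert_iff, Set.mem_singleton_iff] at h1 h2 h3 h4
    ext t
    simp only [Set.mem_insert_iff, Set.mem_singleton_iff]
    grind

/-- A thin polar space of rank `n`: a partial linear space isomorphic to the standard one. -/
def IsThinPolarSpaceOfRank (Q : PartialLinearSpace P) (n : ℕ) : Prop :=
  ∃ (hn : 2 ≤ n) (e : P ≃ Fin n × Bool), Q.IsCollineation (thin n hn) e

/-- The polar Grassmannian of `k`-dimensional singular subspaces. -/
def Grassmannian (Q : PartialLinearSpace P) (k : ℤ) : Type u :=
  {S : Set P // Q.IsSingular S ∧ Q.HasDim S k}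

/-- The polar Grassmann graph formed by `k`-dimensional singular subspaces, for non-maximal
subspaces (`k ≤ n - 2`, where `n` is the rank): two distinct vertices are adjacent if some
`(k + 1)`-dimensional singular subspace contains both. -/
def grassmannGraph (Q : PartialLinearSpace P) (k : ℤ) : SimpleGraph (Q.Grassmannian k) where
  Adj X Y := X ≠ Y ∧ ∃ U, Q.IsSingular U ∧ Q.HasDim U (k + 1) ∧ X.1 ⊆ U ∧ Y.1 ⊆ U
  symm := ⟨fun _ _ h => ⟨h.1.symm, h.2.imp fun _ hU => ⟨hU.1, hU.2.1, hU.2.2.2, hU.2.2.1⟩⟩⟩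
  loopless := ⟨fun _ h => h.1 rfl⟩

/-- A collinearity preserving injection: it sends collinear points to collinear points and
non-collinear points to non-collinear points. -/
def IsCollinearityPreservingInjection (Q : PartialLinearSpace P) (Q' : PartialLinearSpace P')
    (φ : P → P') : Prop :=
  Function.Injective φ ∧ ∀ p q, Q'.Coll (φ p) (φ q) ↔ Q.Coll p q

end PartialLinearSpace

/-- An isometric embedding of graphs: an embedding that preserves the path distance. -/
def SimpleGraph.Embedding.IsIsometric {V : Type u} {W : Type v} {G : SimpleGraph V}
    {H : SimpleGraph W} (f : G ↪g H) : Prop :=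
  ∀ x y : V, H.edist (f x) (f y) = G.edist x y

/-! ### Cliques, perps and the axioms used on both sides -/

namespace PartialLinearSpace

variable {P : Type u} {P' : Type v} {Q : PartialLinearSpace P} {Q' : PartialLinearSpace P'} {n : ℕ}

/-! The vertices of the graph are the hyperplanes of maximal singular subspaces, and the path
distance sees how these maximal subspaces meet: for distinct `X` and `Y` it is one more than the
least codimension of `M ∩ N` over maximal `M ⊇ X` and `N ⊇ Y` (`edist_le_of_le_rank_inter`,
`exists_maximal_of_edist_le`). The dimension theory behind this is a matroid on each clique, resting
on the identity of span and double perp for cliques (`span_eq_perp_perp`), which holds for lines of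
any size.

The hyperplanes of a maximal `M` are pairwise at distance at most 1, so their images lie in one
maximal subspace `F M`. Passing to images never lowers the rank of `M ∩ N`; isometry shows that it
does not raise it either when `M` and `N` share a point (`rank_inter_le_rank_map_inter`,
`rank_map_inter_le`).

For a point `p`, take `M` and `M'` meeting only in `p`. Their images meet in a single point, and
moving through hyperplanes containing `p` shows that this point lies in `F N` for every maximal `N`
through `p` (`exists_mem_map_of_mem`). This defines `φ p`. The crux is that `φ p ∈ f X` exactly when
`p ∈ X` (`map_mem_of_mem`, `map_notMem_of_notMem`): a false incidence would either make two image
vertices too close or identify the images of distinct points. Collinearity in both directions,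
injectivity and the span formula follow from this equivalence. -/

/-- Polar spaces of rank `n` whose lines may have only two points. Polar spaces and thin polar
spaces are both of this kind. -/
structure IsWeakPolarSpaceOfRank (Q : PartialLinearSpace P) (n : ℕ) : Prop where
  no_universal_point : ¬ ∃ p, ∀ q, Q.Coll p q
  one_or_all : ∀ p, ∀ L ∈ Q.lines,
    (∃! q, q ∈ L ∧ Q.Coll p q) ∨ (∀ q ∈ L, Q.Coll p q)
  chain_finite : ∀ C : Set (Set P), (∀ S ∈ C, Q.IsSingular S) → IsChain (· ⊆ ·) C → C.Finite
  dim_maximal : ∀ M, Maximal Q.IsSingular M → Q.HasDim M ((n : ℤ) - 1)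

theorem IsPolarSpaceOfRank.isWeakPolarSpaceOfRank (h : Q.IsPolarSpaceOfRank n) :
    Q.IsWeakPolarSpaceOfRank n :=
  ⟨h.1.no_universal_point, h.1.one_or_all, h.1.chain_finite, h.2⟩

/-- The set of points collinear to all points of `A`. -/
def perp (Q : PartialLinearSpace P) (A : Set P) : Set P := {p | ∀ a ∈ A, Q.Coll p a}

/-- A set of mutually collinear points. -/
def IsClique (Q : PartialLinearSpace P) (A : Set P) : Prop := ∀ p ∈ A, ∀ q ∈ A, Q.Coll p q

/-! ### Spans and perps -/

theorem coll_refl (p : P) : Q.Coll p p :=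
  let ⟨L, hL, hp⟩ := Q.exists_line p
  ⟨L, hL, hp, hp⟩

theorem Coll.symm {p q : P} (h : Q.Coll p q) : Q.Coll q p :=
  let ⟨L, hL, hp, hq⟩ := h
  ⟨L, hL, hq, hp⟩

theorem subset_span (X : Set P) : X ⊆ Q.span X := fun _ hx _ hS => hS.2 hx

theorem isSubspace_span (X : Set P) : Q.IsSubspace (Q.span X) :=
  fun p hp q hq hpq L hL hpL hqL _ hz S hS =>
    hS.1 p (hp S hS) q (hq S hS) hpq L hL hpL hqL hz

theorem span_subset {X S : Set P} (hS : Q.IsSubspace S) (h : X ⊆ S) : Q.span X ⊆ S :=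
  fun _ hx => hx S ⟨hS, h⟩

theorem span_mono {X Y : Set P} (h : X ⊆ Y) : Q.span X ⊆ Q.span Y :=
  span_subset (isSubspace_span Y) (h.trans (subset_span Y))

theorem span_eq {S : Set P} (hS : Q.IsSubspace S) : Q.span S = S :=
  (span_subset hS subset_rfl).antisymm (subset_span S)

theorem span_insert_span (x : P) (X : Set P) :
    Q.span (insert x (Q.span X)) = Q.span (insert x X) := by
  apply subset_antisymm
  · refine span_subset (isSubspace_span _) (Set.insert_subset ?_ ?_)
    · exact subset_span _ (Set.mem_insert _ _)
    · exact span_mono (Set.subset_insert _ _)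
  · exact span_mono (Set.insert_subset_insert (subset_span X))

theorem IsSubspace.inter {S T : Set P} (hS : Q.IsSubspace S) (hT : Q.IsSubspace T) :
    Q.IsSubspace (S ∩ T) :=
  fun p hp q hq hpq L hL hpL hqL _ hz =>
    ⟨hS p hp.1 q hq.1 hpq L hL hpL hqL hz, hT p hp.2 q hq.2 hpq L hL hpL hqL hz⟩

theorem IsClique.subset {A B : Set P} (hB : Q.IsClique B) (h : A ⊆ B) : Q.IsClique A :=
  fun p hp q hq => hB p (h hp) q (h hq)

theorem IsSingular.isClique {S : Set P} (hS : Q.IsSingular S) : Q.IsClique S := hS.2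

theorem IsSingular.inter_left {S T : Set P} (hS : Q.IsSingular S) (hT : Q.IsSubspace T) :
    Q.IsSingular (S ∩ T) :=
  ⟨hS.1.inter hT, hS.isClique.subset Set.inter_subset_left⟩

theorem perp_anti {A B : Set P} (h : A ⊆ B) : Q.perp B ⊆ Q.perp A := fun _ hp a ha => hp a (h ha)

theorem subset_perp_perp (A : Set P) : A ⊆ Q.perp (Q.perp A) := fun _ ha _ hp => (hp _ ha).symm

theorem isClique_iff {A : Set P} : Q.IsClique A ↔ A ⊆ Q.perp A := Iff.rfl

theorem IsClique.perp_perp {A : Set P} (hA : Q.IsClique A) : Q.IsClique (Q.perp (Q.perp A)) :=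
  fun _ hp _ hq => hp _ (perp_anti (isClique_iff.1 hA) hq)

theorem IsClique.insert {A : Set P} (hA : Q.IsClique A) {x : P} (hx : x ∈ Q.perp A) :
    Q.IsClique (insert x A) := by
  rintro p (rfl | hp) q (rfl | hq)
  · exact coll_refl _
  · exact hx q hq
  · exact (hx p hp).symm
  · exact hA p hp q hq

theorem IsClique.union {A B : Set P} (hA : Q.IsClique A) (hB : Q.IsClique B)
    (h : B ⊆ Q.perp A) : Q.IsClique (A ∪ B) := by
  rintro p (hp | hp) q (hq | hq)
  · exact hA p hp q hq
  · exact (h hq p hp).symm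
  · exact h hp q hq
  · exact hB p hp q hq

theorem isSingular_singleton (p : P) : Q.IsSingular {p} := by
  refine ⟨fun a ha b hb hab => absurd (ha.trans hb.symm) hab, ?_⟩
  rintro a rfl b rfl
  exact coll_refl _

theorem isSingular_empty : Q.IsSingular ∅ :=
  ⟨fun _ ha => ha.elim, fun _ ha => ha.elim⟩

namespace IsWeakPolarSpaceOfRank

variable (h : Q.IsWeakPolarSpaceOfRank n)
include h

theorem exists_mem_line_coll (p : P) {L : Set P} (hL : L ∈ Q.lines) : ∃ q ∈ L, Q.Coll p q := by
  rcases h.one_or_all p L hL with ⟨q, hq, -⟩ | hall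
  · exact ⟨q, hq.1, hq.2⟩
  · obtain ⟨q, hq⟩ := (Q.line_nontrivial L hL).nonempty
    exact ⟨q, hq, hall q hq⟩

theorem coll_of_mem_line {p a b c : P} {L : Set P} (hL : L ∈ Q.lines) (ha : a ∈ L) (hb : b ∈ L)
    (hc : c ∈ L) (hab : a ≠ b) (hpa : Q.Coll p a) (hpb : Q.Coll p b) : Q.Coll p c := by
  rcases h.one_or_all p L hL with ⟨q, -, hq⟩ | hall
  · exact absurd ((hq a ⟨ha, hpa⟩).trans (hq b ⟨hb, hpb⟩).symm) hab
  · exact hall c hc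

theorem isSubspace_perp (A : Set P) : Q.IsSubspace (Q.perp A) :=
  fun _ hp _ hq hpq _ hL hpL hqL _ hz a ha =>
    (h.coll_of_mem_line hL hpL hqL hz hpq (hp a ha).symm (hq a ha).symm).symm

theorem span_subset_perp_perp (A : Set P) : Q.span A ⊆ Q.perp (Q.perp A) :=
  span_subset (h.isSubspace_perp _) (subset_perp_perp A)

theorem perp_span (A : Set P) : Q.perp (Q.span A) = Q.perp A :=
  (perp_anti (subset_span A)).antisymm
    fun _ hp _ ha => (h.span_subset_perp_perp A ha _ hp).symm

theorem isSingular_span {A : Set P} (hA : Q.IsClique A) : Q.IsSingular (Q.span A) :=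
  ⟨isSubspace_span A, hA.perp_perp.subset (h.span_subset_perp_perp A)⟩

/-- If the conclusion fails, some `q` in the perp of `A` and `z` is not collinear to `x`, and some
`q'` in the perp of `A` is not collinear to `z`. Two applications of the one-or-all axiom give `r`
on the line `qz` collinear to `q'`, then `t` on the line `q'r` collinear to `x`. Now `t` is in the
perp of `insert x A`, so `z` is collinear to `t` and `r`, hence to `q'`. -/
theorem perp_perp_exchange {A : Set P} {x z : P} (hA : Q.IsClique (insert x A))
    (hz : z ∈ Q.perp (Q.perp (insert x A))) (hzA : z ∉ Q.perp (Q.perp A)) :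
    x ∈ Q.perp (Q.perp (insert z A)) := by
  by_contra hx
  simp only [perp, Set.mem_ofPred_eq, not_forall] at hx hzA
  obtain ⟨q, hq, hxq⟩ := hx
  obtain ⟨q', hq', hzq'⟩ := hzA
  have hqz : Q.Coll q z := hq z (Set.mem_insert _ _)
  have hqA : ∀ a ∈ A, Q.Coll q a := fun a ha => hq a (Set.mem_insert_of_mem _ ha)
  have hzmem : ∀ a ∈ insert x A, Q.Coll z a := fun a ha =>
    hz a (isClique_iff.1 hA ha)
  have hzx : Q.Coll z x := hzmem x (Set.mem_insert _ _)
  have hzA' : ∀ a ∈ A, Q.Coll z a := fun a ha => hzmem a (Set.mem_insert_of_mem _ ha)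
  obtain ⟨L, hL, hqL, hzL⟩ := hqz
  obtain ⟨r, hrL, hr⟩ := h.exists_mem_line_coll q' hL
  have hrz : r ≠ z := by rintro rfl; exact hzq' hr.symm
  have hrx : ¬ Q.Coll x r := fun hxr => hxq (h.coll_of_mem_line hL hrL hzL hqL hrz hxr hzx.symm)
  have hqz' : q ≠ z := by rintro rfl; exact hxq hzx.symm
  have hrA : ∀ a ∈ A, Q.Coll r a := fun a ha =>
    (h.coll_of_mem_line hL hqL hzL hrL hqz' (hqA a ha).symm (hzA' a ha).symm).symm
  have hzr : Q.Coll z r := ⟨L, hL, hzL, hrL⟩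
  have hrq' : r ≠ q' := by rintro rfl; exact hzq' hzr
  obtain ⟨K, hK, hq'K, hrK⟩ := hr
  obtain ⟨t, htK, hxt⟩ := h.exists_mem_line_coll x hK
  have htr : t ≠ r := by rintro rfl; exact hrx hxt
  have htA : ∀ a ∈ insert x A, Q.Coll t a := by
    rintro a (rfl | ha)
    · exact hxt.symm
    · exact (h.coll_of_mem_line hK hq'K hrK htK hrq'.symm (hq' a ha).symm (hrA a ha).symm).symm
  exact hzq' (h.coll_of_mem_line hK htK hrK hq'K htr (hz t htA) hzr)

/-- Take `q` in the perp of `S` not collinear to `x`. For `z` in the double perp, the line `zx` has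
a point `w` collinear to `q`. Exchange forces `w ∈ S`, so `z` lies on a line joining `x` to a point
of `S`. -/
theorem span_insert_eq_perp_perp {S : Set P} (hS : Q.IsClique S)
    (hcl : Q.perp (Q.perp S) = S) {x : P} (hx : x ∈ Q.perp S) :
    Q.span (insert x S) = Q.perp (Q.perp (insert x S)) := by
  refine (h.span_subset_perp_perp _).antisymm fun z hz => ?_
  have hxs : x ∈ Q.span (insert x S) := subset_span _ (Set.mem_insert _ _)
  by_cases hxS : x ∈ S
  · rw [Set.insert_eq_of_mem hxS, hcl] at hz
    exact subset_span _ (Set.mem_insert_of_mem _ hz)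
  by_cases hzx : z = x
  · rwa [hzx]
  have hxS' := hxS
  rw [← hcl] at hxS'
  simp only [perp, Set.mem_ofPred_eq, not_forall] at hxS'
  obtain ⟨q, hq, hxq⟩ := hxS'
  have hclique := hS.insert hx
  have hxcl := subset_perp_perp (Q := Q) (insert x S) (Set.mem_insert x S)
  obtain ⟨L, hL, hzL, hxL⟩ := hclique.perp_perp z hz x hxcl
  obtain ⟨w, hwL, hqw⟩ := h.exists_mem_line_coll q hL
  have hwx : w ≠ x := by rintro rfl; exact hxq hqw.symm
  have hw : w ∈ Q.perp (Q.perp (insert x S)) :=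
    h.isSubspace_perp _ z hz x hxcl hzx L hL hzL hxL hwL
  by_cases hwS : w ∈ S
  · exact isSubspace_span _ w (subset_span _ (Set.mem_insert_of_mem _ hwS)) x hxs hwx L hL hwL hxL
      hzL
  · refine absurd (h.perp_perp_exchange hclique hw (by rwa [hcl]) q ?_) hxq
    rintro a (rfl | ha)
    · exact hqw
    · exact hq a ha

theorem span_eq_perp_perp_of_finite {X : Set P} (hX : X.Finite) (hc : Q.IsClique X) :
    Q.span X = Q.perp (Q.perp X) := by
  induction X, hX using Set.Finite.induction_on with
  | empty =>
    -- The perp of `∅` is the whole space, so a point of its double perp would be collinear to all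
    -- points.
    refine (h.span_subset_perp_perp _).antisymm fun z hz => ?_
    exact absurd ⟨z, fun q => hz q (by simp [perp])⟩ h.no_universal_point
  | @insert a s ha hs ih =>
    have hs' := hc.subset (Set.subset_insert a s)
    have ih := ih hs'
    have hsing := h.isSingular_span hs'
    have hcl : Q.perp (Q.perp (Q.span s)) = Q.span s := by rw [h.perp_span, ih]
    have hperp : Q.perp (insert a (Q.span s)) = Q.perp (insert a s) := by
      rw [← h.perp_span, span_insert_span, h.perp_span]
    have ha' : a ∈ Q.perp (Q.span s) := by
      rw [h.perp_span]
      exact fun b hb => hc a (Set.mem_insert _ _) b (Set.mem_insert_of_mem _ hb)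
    rw [← span_insert_span, h.span_insert_eq_perp_perp hsing.2 hcl ha', hperp]

theorem wellFounded_ssuperset :
    WellFounded fun S T : {S : Set P // Q.IsSingular S} => T < S := by
  rw [RelEmbedding.wellFounded_iff_isEmpty]
  refine ⟨fun g => ?_⟩
  have hmono : StrictMono g := fun a b hab => g.map_rel_iff.2 hab
  have hinj : Function.Injective fun k => (g k).1 :=
    Subtype.val_injective.comp hmono.injective
  refine Set.infinite_range_of_injective hinj (h.chain_finite _ ?_ ?_)
  · rintro _ ⟨k, rfl⟩
    exact (g k).2
  · rintro _ ⟨k, rfl⟩ _ ⟨l, rfl⟩ -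
    rcases le_total k l with hkl | hkl
    · exact Or.inl (hmono.monotone hkl)
    · exact Or.inr (hmono.monotone hkl)

/-- Any property that holds for some singular subspace holds for a maximal one. -/
theorem exists_maximal_of {p : Set P → Prop} (hp : ∃ S, Q.IsSingular S ∧ p S) :
    ∃ S, Q.IsSingular S ∧ p S ∧ ∀ T, Q.IsSingular T → p T → S ⊆ T → T = S := by
  obtain ⟨S, hS, hpS⟩ := hp
  obtain ⟨M, hM, hmax⟩ := h.wellFounded_ssuperset.has_min {S | p S.1} ⟨⟨S, hS⟩, hpS⟩
  refine ⟨M.1, M.2, hM, fun T hT hpT hMT => ?_⟩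
  by_contra hne
  exact hmax ⟨T, hT⟩ hpT (lt_of_le_of_ne hMT fun he => hne (congrArg Subtype.val he).symm)

/-- By the chain condition some span of a finite subset of `A` is maximal among such spans; it must
absorb every point of `A`. -/
theorem exists_finite_span_eq {A : Set P} (hA : Q.IsClique A) :
    ∃ X ⊆ A, X.Finite ∧ Q.span X = Q.span A := by
  obtain ⟨S, hS, ⟨X, hXA, hX, rfl⟩, hmax⟩ := h.exists_maximal_of
    (p := fun S => ∃ X ⊆ A, X.Finite ∧ Q.span X = S)
    ⟨Q.span ∅, h.isSingular_span (hA.subset (Set.empty_subset _)), ∅, Set.empty_subset _,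
      Set.finite_empty, rfl⟩
  refine ⟨X, hXA, hX, (span_mono hXA).antisymm (span_subset (isSubspace_span X) fun a ha => ?_)⟩
  have hins : insert a X ⊆ A := Set.insert_subset ha hXA
  rw [← hmax _ (h.isSingular_span (hA.subset hins)) ⟨_, hins, hX.insert a, rfl⟩
    (span_mono (Set.subset_insert a X))]
  exact subset_span _ (Set.mem_insert _ _)

theorem span_eq_perp_perp {A : Set P} (hA : Q.IsClique A) : Q.span A = Q.perp (Q.perp A) := by
  obtain ⟨X, hXA, hX, hs⟩ := h.exists_finite_span_eq hA
  rw [← hs, h.span_eq_perp_perp_of_finite hX (hA.subset hXA), ← h.perp_span X, hs, h.perp_span]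

theorem exchange {A : Set P} {x z : P} (hA : Q.IsClique (insert x A))
    (hz : z ∈ Q.span (insert x A)) (hzA : z ∉ Q.span A) : x ∈ Q.span (insert z A) := by
  have hA' : Q.IsClique A := hA.subset (Set.subset_insert _ _)
  have hzc : Q.IsClique (insert z A) := (h.isSingular_span hA).isClique.subset
    (Set.insert_subset hz ((Set.subset_insert x A).trans (subset_span _)))
  rw [h.span_eq_perp_perp hA] at hz
  rw [h.span_eq_perp_perp hA'] at hzA
  rw [h.span_eq_perp_perp hzc]
  exact h.perp_perp_exchange hA hz hzA

/-- A point outside a singular subspace is separated from it by the perp of a point. -/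
theorem exists_mem_perp_not_coll {S : Set P} (hS : Q.IsSingular S) {x : P} (hx : x ∉ S) :
    ∃ q ∈ Q.perp S, ¬ Q.Coll x q := by
  rw [← span_eq hS.1, h.span_eq_perp_perp hS.2] at hx
  simpa [perp] using hx

end IsWeakPolarSpaceOfRank

/-! ### Thin polar spaces -/

theorem IsCollineation.mem_lines_iff {hn : 2 ≤ n} {e : P ≃ Fin n × Bool}
    (he : Q.IsCollineation (thin n hn) e) (L : Set P) :
    L ∈ Q.lines ↔ ∃ x y, (e x).1 ≠ (e y).1 ∧ L = {x, y} := by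
  have hinj : Function.Injective fun L : Set P => e '' L := e.injective.image_injective
  rw [← hinj.mem_set_image (s := Q.lines), show (fun L : Set P => e '' L) '' Q.lines = _ from he]
  constructor
  · rintro ⟨x, y, hxy, hL⟩
    refine ⟨e.symm x, e.symm y, by simpa using hxy, hinj ?_⟩
    simpa [Set.image_pair] using hL
  · rintro ⟨x, y, hxy, rfl⟩
    exact ⟨e x, e y, hxy, Set.image_pair e x y⟩

theorem IsCollineation.coll_iff {hn : 2 ≤ n} {e : P ≃ Fin n × Bool}
    (he : Q.IsCollineation (thin n hn) e) {p q : P} :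
    Q.Coll p q ↔ p = q ∨ (e p).1 ≠ (e q).1 := by
  constructor
  · rintro ⟨L, hL, hp, hq⟩
    obtain ⟨x, y, hxy, rfl⟩ := (he.mem_lines_iff L).1 hL
    rcases hp with rfl | rfl <;> rcases hq with rfl | rfl
    · exact Or.inl rfl
    · exact Or.inr hxy
    · exact Or.inr hxy.symm
    · exact Or.inl rfl
  · rintro (rfl | hpq)
    · exact coll_refl p
    · exact ⟨{p, q}, (he.mem_lines_iff _).2 ⟨p, q, hpq, rfl⟩, by simp, by simp⟩

theorem IsCollineation.isSubspace {hn : 2 ≤ n} {e : P ≃ Fin n × Bool}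
    (he : Q.IsCollineation (thin n hn) e) (S : Set P) : Q.IsSubspace S := by
  intro p hp q hq hpq L hL hpL hqL
  obtain ⟨x, y, hxy, rfl⟩ := (he.mem_lines_iff L).1 hL
  rintro z (rfl | rfl) <;> rcases hpL with rfl | rfl <;> rcases hqL with rfl | rfl <;>
    first | assumption | exact absurd rfl hpq

theorem IsThinPolarSpaceOfRank.isWeakPolarSpaceOfRank (h : Q.IsThinPolarSpaceOfRank n) :
    Q.IsWeakPolarSpaceOfRank n := by
  obtain ⟨hn, e, he⟩ := h
  have : Finite P := Finite.of_equiv _ e.symm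
  refine ⟨?_, ?_, fun C _ _ => C.toFinite, ?_⟩
  · rintro ⟨p, hp⟩
    rcases he.coll_iff.1 (hp (e.symm ((e p).1, !(e p).2))) with h1 | h1
    · have := congrArg (fun x => (e x).2) h1
      simp at this
    · simp at h1
  · intro p L hL
    obtain ⟨x, y, hxy, rfl⟩ := (he.mem_lines_iff L).1 hL
    by_cases hx : Q.Coll p x
    · by_cases hy : Q.Coll p y
      · refine Or.inr ?_
        rintro q (rfl | rfl) <;> assumption
      · refine Or.inl ⟨x, ⟨by simp, hx⟩, ?_⟩
        rintro q ⟨rfl | rfl, hq⟩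
        · rfl
        · exact absurd hq hy
    · refine Or.inl ⟨y, ⟨by simp, he.coll_iff.2 (Or.inr ?_)⟩, ?_⟩
      · rw [he.coll_iff, not_or, not_not] at hx
        rwa [hx.2]
      · rintro q ⟨rfl | rfl, hq⟩
        · exact absurd hq hx
        · rfl
  · intro M hM
    have hspan : ∀ X : Set P, Q.span X = X := fun X => span_eq (he.isSubspace X)
    refine ⟨M, M.toFinite, ?_, fun x _ hx => (by simp [hspan] at hx), hspan M⟩
    have hinj : Set.InjOn (fun p => (e p).1) M := fun p hp q hq hpq =>
      (he.coll_iff.1 (hM.1.2 p hp q hq)).resolve_right (not_not.2 hpq)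
    -- If no point of `M` has coordinate `i`, then `(i, true)` can be added to `M`.
    have hsurj : (fun p => (e p).1) '' M = Set.univ := by
      refine Set.eq_univ_of_forall fun i => ?_
      by_contra hi
      have hx : e.symm (i, true) ∈ Q.perp M := fun a ha => he.coll_iff.2 (Or.inr fun hia =>
        hi ⟨a, ha, by simpa using hia.symm⟩)
      have hmem := hM.2 (y := insert (e.symm (i, true)) M)
        ⟨he.isSubspace _, IsClique.insert hM.1.2 hx⟩ (Set.subset_insert _ _) (Set.mem_insert _ _)
      exact hi ⟨_, hmem, by simp⟩
    rw [← hinj.ncard_image, hsurj, Set.ncard_univ]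
    simp

/-! ### Rank of singular subspaces -/

theorem Indep.subset {I J : Set P} (hJ : Q.Indep J) (h : I ⊆ J) : Q.Indep I :=
  fun x hx hmem => hJ x (h hx) (span_mono (Set.sdiff_subset_sdiff_left h) hmem)

theorem Indep.eq_of_subset_of_span_eq {I J : Set P} (hJ : Q.Indep J) (hIJ : I ⊆ J)
    (hs : J ⊆ Q.span I) : I = J := by
  refine hIJ.antisymm fun x hx => ?_
  by_contra hxI
  exact hJ x hx (span_mono (Set.subset_sdiff_singleton hIJ hxI) (hs hx))

/-- The rank of a singular subspace: its projective dimension plus one. -/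
noncomputable def rank (Q : PartialLinearSpace P) (S : Set P) : ℕ :=
  sInf {k : ℕ | Q.HasDim S ((k : ℤ) - 1)}

theorem maximal_of_perp_subset {S : Set P} (hS : Q.IsSingular S) (hp : Q.perp S ⊆ S) :
    Maximal Q.IsSingular S :=
  ⟨hS, fun _ hT hST _ hx => hp fun a ha => hT.2 _ hx a (hST ha)⟩

theorem eq_of_maximal_subset {M N : Set P} (hM : Maximal Q.IsSingular M)
    (hN : Q.IsSingular N) (hMN : M ⊆ N) : M = N :=
  hMN.antisymm (hM.2 hN hMN)

namespace IsWeakPolarSpaceOfRank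

variable (h : Q.IsWeakPolarSpaceOfRank n)
include h

theorem indep_insert {I : Set P} {x : P} (hI : Q.Indep I) (hc : Q.IsClique (insert x I))
    (hx : x ∉ Q.span I) : Q.Indep (insert x I) := by
  have hxI : x ∉ I := fun hxI => hx (subset_span I hxI)
  rintro y (rfl | hy) hmem
  · rw [Set.insert_sdiff_of_mem _ (Set.mem_singleton y), Set.sdiff_singleton_eq_self hxI] at hmem
    exact hx hmem
  · have hyx : x ≠ y := by rintro rfl; exact hxI hy
    rw [Set.insert_sdiff_of_notMem _ (by simpa using hyx)] at hmem
    have := h.exchange (hc.subset (Set.insert_subset_insert Set.sdiff_subset)) hmem (hI y hy)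
    rw [Set.insert_sdiff_singleton, Set.insert_eq_of_mem hy] at this
    exact hx this

theorem finite_of_indep {I : Set P} (hc : Q.IsClique I) (hI : Q.Indep I) : I.Finite := by
  obtain ⟨X, hXI, hX, hs⟩ := h.exists_finite_span_eq hc
  rwa [← hI.eq_of_subset_of_span_eq hXI (hs ▸ subset_span I)]

/-- The matroid of independent subsets of a clique. -/
def matroidOn {C : Set P} (hC : Q.IsClique C) : Matroid P :=
  (IndepMatroid.ofFinitary C (fun X => X ⊆ C ∧ Q.Indep X)
    ⟨Set.empty_subset C, fun _ hx => hx.elim⟩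
    (fun _ _ hJ hIJ => ⟨hIJ.trans hJ.1, hJ.2.subset hIJ⟩)
    (by
      rintro I B ⟨hIC, hI⟩ hnot hB
      -- If no element of `B` augments `I`, then `I` spans `B`. As a maximal independent set, `B`
      -- spans `C`, so `I` spans `C` and is itself maximal.
      by_contra! hcon
      have hBI : B ⊆ Q.span I := fun x hx => by
        by_contra hxI
        have hc := Set.insert_subset (hB.1.1 hx) hIC
        exact hcon x ⟨hx, fun hxI' => hxI (subset_span I hxI')⟩
          hc (h.indep_insert hI (hC.subset hc) hxI)
      have hCB : C ⊆ Q.span B := fun x hx => by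
        by_contra hxB
        have hc := Set.insert_subset hx hB.1.1
        exact hxB (subset_span B (hB.2 (y := insert x B)
          ⟨hc, h.indep_insert hB.1.2 (hC.subset hc) hxB⟩ (Set.subset_insert x B) (Set.mem_insert x B)))
      refine hnot ⟨⟨hIC, hI⟩, fun J hJ hIJ => (hJ.2.eq_of_subset_of_span_eq hIJ ?_).ge⟩
      exact hJ.1.trans (hCB.trans (span_subset (isSubspace_span I) hBI)))
    (by
      intro I hI
      have hIC : I ⊆ C := fun x hx =>
        (hI {x} (Set.singleton_subset_iff.2 hx) (Set.finite_singleton x)).1 rfl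
      refine ⟨hIC, fun x hx hmem => ?_⟩
      obtain ⟨X, hXI, hX, hs⟩ := h.exists_finite_span_eq
        (hC.subset (Set.sdiff_subset.trans hIC : I \ {x} ⊆ C))
      have hxX : x ∉ X := fun hxX => (hXI hxX).2 rfl
      refine (hI (insert x X) (Set.insert_subset hx (hXI.trans Set.sdiff_subset))
        (hX.insert x)).2 x (Set.mem_insert x X) ?_
      rw [Set.insert_sdiff_of_mem _ (Set.mem_singleton x), Set.sdiff_singleton_eq_self hxX, hs]
      exact hmem)
    (fun _ hI => hI.1)).matroid

/-- The right side does not mention `C`, so matroid rank agrees with geometric dimension whatever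
the ambient clique. -/
theorem isBasis_iff {C S I : Set P} (hC : Q.IsClique C) (hS : Q.IsSingular S) (hSC : S ⊆ C) :
    (h.matroidOn hC).IsBasis I S ↔ Q.Indep I ∧ Q.span I = S := by
  constructor
  · intro hI
    refine ⟨hI.indep.2, (span_subset hS.1 hI.subset).antisymm fun x hx => ?_⟩
    by_contra hxI
    have hc := Set.insert_subset hx hI.subset
    exact hxI (subset_span I (hI.mem_of_insert_indep hx
      ⟨hc.trans hSC, h.indep_insert hI.indep.2 (hS.isClique.subset hc) hxI⟩))
  · rintro ⟨hI, rfl⟩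
    refine Matroid.Indep.isBasis_of_forall_insert ⟨(subset_span I).trans hSC, hI⟩ (subset_span I)
      fun x hx => ?_
    refine ⟨fun hins => ?_, Set.insert_subset (hSC hx.1) ((subset_span I).trans hSC)⟩
    exact hx.2 ((hins.2.eq_of_subset_of_span_eq (Set.subset_insert x I)
      (Set.insert_subset hx.1 (subset_span I))).ge (Set.mem_insert x I))

theorem exists_basis {S : Set P} (hS : Q.IsSingular S) :
    ∃ I, I.Finite ∧ Q.Indep I ∧ Q.span I = S := by
  obtain ⟨I, hI⟩ := (h.matroidOn hS.2).exists_isBasis S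
  have := (h.isBasis_iff hS.2 hS subset_rfl).1 hI
  exact ⟨I, h.finite_of_indep (hS.isClique.subset hI.subset) this.1, this⟩

theorem rank_eq_ncard {S I : Set P} (hS : Q.IsSingular S) (hI : Q.Indep I)
    (hs : Q.span I = S) : Q.rank S = I.ncard := by
  have key : ∀ J, Q.Indep J → Q.span J = S → J.ncard = I.ncard := fun J hJ hJs => by
    have hJ' := (h.isBasis_iff hS.2 hS subset_rfl).2 ⟨hJ, hJs⟩
    have hI' := (h.isBasis_iff hS.2 hS subset_rfl).2 ⟨hI, hs⟩
    rw [Set.ncard, Set.ncard, hJ'.encard_eq_eRk, hI'.encard_eq_eRk]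
  have hset : {k : ℕ | Q.HasDim S ((k : ℤ) - 1)} = {I.ncard} := by
    ext k
    rw [Set.mem_singleton_iff]
    constructor
    · rintro ⟨J, -, hk, hJ, hJs⟩
      rw [key J hJ hJs] at hk
      omega
    · rintro rfl
      exact ⟨I, h.finite_of_indep (hS.isClique.subset (hs ▸ subset_span I)) hI, by simp, hI, hs⟩
  rw [rank, hset, csInf_singleton]

theorem hasDim_iff {S : Set P} (hS : Q.IsSingular S) {k : ℤ} :
    Q.HasDim S k ↔ (Q.rank S : ℤ) = k + 1 := by
  constructor
  · rintro ⟨J, -, hk, hJ, hJs⟩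
    rw [h.rank_eq_ncard hS hJ hJs, hk]
  · intro hk
    obtain ⟨I, hfin, hI, hs⟩ := h.exists_basis hS
    exact ⟨I, hfin, by rw [← hk, h.rank_eq_ncard hS hI hs], hI, hs⟩

theorem eRk_matroidOn {C S : Set P} (hC : Q.IsClique C) (hS : Q.IsSingular S) (hSC : S ⊆ C) :
    (h.matroidOn hC).eRk S = Q.rank S := by
  obtain ⟨I, hfin, hI, hs⟩ := h.exists_basis hS
  rw [h.rank_eq_ncard hS hI hs, ← ((h.isBasis_iff hC hS hSC).2 ⟨hI, hs⟩).encard_eq_eRk,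
    hfin.cast_ncard_eq]

theorem rank_mono {S T : Set P} (hS : Q.IsSingular S) (hT : Q.IsSingular T) (hST : S ⊆ T) :
    Q.rank S ≤ Q.rank T := by
  have := (h.matroidOn hT.2).eRk_mono hST
  rw [h.eRk_matroidOn hT.2 hS hST, h.eRk_matroidOn hT.2 hT subset_rfl] at this
  exact_mod_cast this

theorem eq_of_subset_of_rank_le {S T : Set P} (hS : Q.IsSingular S) (hT : Q.IsSingular T)
    (hST : S ⊆ T) (hr : Q.rank T ≤ Q.rank S) : S = T := by
  obtain ⟨I, J, hI, hJ, hIJ⟩ := (h.matroidOn hT.2).exists_isBasis_subset_isBasis hST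
  have hI' := (h.isBasis_iff hT.2 hS hST).1 hI
  have hJ' := (h.isBasis_iff hT.2 hT subset_rfl).1 hJ
  rw [h.rank_eq_ncard hS hI'.1 hI'.2, h.rank_eq_ncard hT hJ'.1 hJ'.2] at hr
  have hfin := h.finite_of_indep (hT.isClique.subset hJ.subset) hJ'.1
  rw [← hI'.2, ← hJ'.2, Set.eq_of_subset_of_ncard_le hIJ hr hfin]

theorem rank_lt_of_ssubset {S T : Set P} (hS : Q.IsSingular S) (hT : Q.IsSingular T)
    (hST : S ⊂ T) : Q.rank S < Q.rank T := by
  by_contra! hr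
  exact hST.ne (h.eq_of_subset_of_rank_le hS hT hST.subset hr)

theorem rank_span_insert {S : Set P} (hS : Q.IsSingular S) {x : P} (hx : x ∈ Q.perp S)
    (hxS : x ∉ S) : Q.rank (Q.span (insert x S)) = Q.rank S + 1 := by
  obtain ⟨I, hfin, hI, hs⟩ := h.exists_basis hS
  have hc := hS.isClique.insert hx
  have hxI : x ∉ Q.span I := by rwa [hs]
  have hsub : insert x I ⊆ insert x S := Set.insert_subset_insert (hs ▸ subset_span I)
  rw [h.rank_eq_ncard hS hI hs, h.rank_eq_ncard (h.isSingular_span hc)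
    (h.indep_insert hI (hc.subset hsub) hxI) (by rw [← span_insert_span, hs]),
    Set.ncard_insert_of_notMem (fun hx' => hxI (subset_span I hx')) hfin]

theorem rank_empty : Q.rank ∅ = 0 := by
  rw [h.rank_eq_ncard isSingular_empty (fun _ hx => hx.elim) (span_eq isSingular_empty.1),
    Set.ncard_empty]

theorem rank_singleton (p : P) : Q.rank {p} = 1 := by
  have := h.rank_span_insert isSingular_empty (x := p) (fun _ ha => ha.elim) (fun hx => hx)
  rwa [h.rank_empty, insert_empty_eq, span_eq (isSingular_singleton p).1] at this

theorem one_le_rank {S : Set P} (hS : Q.IsSingular S) {p : P} (hp : p ∈ S) : 1 ≤ Q.rank S := by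
  rw [← h.rank_singleton p]
  exact h.rank_mono (isSingular_singleton p) hS (Set.singleton_subset_iff.2 hp)

theorem nonempty_of_rank_pos {S : Set P} (hr : 0 < Q.rank S) : S.Nonempty := by
  rw [Set.nonempty_iff_ne_empty]
  rintro rfl
  rw [h.rank_empty] at hr
  exact hr.false

theorem eq_of_rank_le_one {S : Set P} (hS : Q.IsSingular S) (hr : Q.rank S ≤ 1) {p q : P}
    (hp : p ∈ S) (hq : q ∈ S) : p = q := by
  have := h.eq_of_subset_of_rank_le (isSingular_singleton p) hS (Set.singleton_subset_iff.2 hp)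
    (by rwa [h.rank_singleton])
  rw [← this] at hq
  exact hq.symm

theorem exists_ne_of_two_le_rank {S : Set P} (hr : 2 ≤ Q.rank S) (p : P) :
    ∃ q ∈ S, q ≠ p := by
  by_contra! hcon
  obtain ⟨q, hq⟩ := h.nonempty_of_rank_pos (by omega : 0 < Q.rank S)
  have : S = {p} := by
    ext x
    exact ⟨hcon x, by rintro rfl; exact hcon q hq ▸ hq⟩
  rw [this, h.rank_singleton] at hr
  omega

/-! ### Maximal singular subspaces -/

theorem exists_maximal_superset {A : Set P} (hA : Q.IsClique A) :
    ∃ M, Maximal Q.IsSingular M ∧ A ⊆ M := by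
  obtain ⟨M, hM, hAM, hmax⟩ := h.exists_maximal_of (p := fun S => A ⊆ S)
    ⟨_, h.isSingular_span hA, subset_span A⟩
  exact ⟨M, ⟨hM, fun T hT hMT => (hmax T hT (hAM.trans hMT) hMT).le⟩, hAM⟩

theorem rank_maximal {M : Set P} (hM : Maximal Q.IsSingular M) : Q.rank M = n := by
  have := (h.hasDim_iff hM.1).1 (h.dim_maximal M hM)
  omega

theorem rank_le {S : Set P} (hS : Q.IsSingular S) : Q.rank S ≤ n := by
  obtain ⟨M, hM, hSM⟩ := h.exists_maximal_superset hS.2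
  exact h.rank_maximal hM ▸ h.rank_mono hS hM.1 hSM

theorem maximal_iff {S : Set P} (hS : Q.IsSingular S) :
    Maximal Q.IsSingular S ↔ Q.rank S = n := by
  refine ⟨h.rank_maximal, fun hr => ⟨hS, fun T hT hST => ?_⟩⟩
  exact (h.eq_of_subset_of_rank_le hS hT hST (hr ▸ h.rank_le hT)).ge

theorem perp_maximal {M : Set P} (hM : Maximal Q.IsSingular M) : Q.perp M = M := by
  refine subset_antisymm (fun x hx => ?_) hM.1.2
  exact hM.2 (h.isSingular_span (hM.1.isClique.insert hx))
    ((Set.subset_insert x M).trans (subset_span _)) (subset_span _ (Set.mem_insert x M))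

theorem two_le : 2 ≤ n := by
  obtain ⟨p⟩ := Q.nonempty
  obtain ⟨L, hL, -⟩ := Q.exists_line p
  obtain ⟨a, ha, b, hb, hab⟩ := Q.line_nontrivial L hL
  have hperp : b ∈ Q.perp {a} := by
    rintro c rfl
    exact ⟨L, hL, hb, ha⟩
  have hr := h.rank_span_insert (isSingular_singleton a) hperp (Ne.symm hab)
  rw [h.rank_singleton] at hr
  have := h.rank_le (h.isSingular_span ((isSingular_singleton a).isClique.insert hperp))
  omega

/-- Taking the points of a singular subspace collinear to a given point lowers the rank by at most
one. -/
theorem rank_le_rank_inter_perp_singleton {S : Set P} (hS : Q.IsSingular S) (p : P) :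
    Q.rank S ≤ Q.rank (S ∩ Q.perp {p}) + 1 := by
  set H := S ∩ Q.perp {p} with hH
  have hHs : Q.IsSingular H := hS.inter_left (h.isSubspace_perp _)
  by_cases hSH : S ⊆ H
  · exact (h.rank_mono hS hHs hSH).trans (Nat.le_succ _)
  obtain ⟨x, hx, hxH⟩ := Set.not_subset.1 hSH
  have hxp : x ∈ Q.perp H := fun a ha => hS.2 x hx a ha.1
  rw [← h.rank_span_insert hHs hxp hxH]
  refine h.rank_mono hS (h.isSingular_span (hHs.isClique.insert hxp)) fun y hy => ?_
  have hxs : x ∈ Q.span (insert x H) := subset_span _ (Set.mem_insert _ _)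
  by_cases hyx : y = x
  · rwa [hyx]
  obtain ⟨L, hL, hyL, hxL⟩ := hS.2 y hy x hx
  obtain ⟨w, hwL, hpw⟩ := h.exists_mem_line_coll p hL
  have hw : w ∈ H := by
    refine ⟨hS.1 y hy x hx hyx L hL hyL hxL hwL, ?_⟩
    rintro a rfl
    exact hpw.symm
  exact isSubspace_span _ w (subset_span _ (Set.mem_insert_of_mem _ hw)) x hxs
    (by rintro rfl; exact hxH hw) L hL hwL hxL hyL

/-- Two subspaces of a singular subspace meet at least in the expected rank. -/
theorem rank_add_rank_le {S T U : Set P} (hS : Q.IsSingular S) (hT : Q.IsSingular T)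
    (hU : Q.IsSingular U) (hSU : S ⊆ U) (hTU : T ⊆ U) :
    Q.rank S + Q.rank T ≤ Q.rank (S ∩ T) + Q.rank U := by
  obtain ⟨d, hd⟩ : ∃ d, Q.rank U = Q.rank S + d := Nat.exists_eq_add_of_le (h.rank_mono hS hU hSU)
  induction d generalizing T U with
  | zero =>
    rw [h.eq_of_subset_of_rank_le hS hU hSU hd.le, Set.inter_eq_right.2 hTU]
    omega
  | succ d ih =>
    have hne : ¬ U ⊆ S := fun hUS => by have := h.rank_mono hU hS hUS; omega
    obtain ⟨x, hxU, hxS⟩ := Set.not_subset.1 hne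
    -- Cutting by the perp of `q` keeps `S` and `S ∩ T`, lowers the rank of `U` by exactly one and
    -- that of `T` by at most one.
    obtain ⟨q, hq, hxq⟩ := h.exists_mem_perp_not_coll hS hxS
    have hSq : S ⊆ Q.perp {q} := by
      rintro a ha b rfl
      exact (hq a ha).symm
    have hU1 := hU.inter_left (h.isSubspace_perp {q})
    have hlt := h.rank_lt_of_ssubset hU1 hU
      ⟨Set.inter_subset_left, fun hsub => hxq ((hsub hxU).2 q rfl)⟩
    have hU2 := h.rank_le_rank_inter_perp_singleton hU q
    have hT2 := h.rank_le_rank_inter_perp_singleton hT q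
    have := ih (hT.inter_left (h.isSubspace_perp {q})) hU1 (Set.subset_inter hSU hSq)
      (Set.inter_subset_inter_left _ hTU) (by omega)
    rw [Set.inter_comm T, ← Set.inter_assoc, Set.inter_eq_left.2 hSq] at this
    rw [Set.inter_comm T] at hT2
    omega

theorem perp_span_insert (x : P) (S : Set P) :
    Q.perp (Q.span (insert x S)) = Q.perp S ∩ Q.perp {x} := by
  rw [h.perp_span]
  ext y
  simp [perp, and_comm]

/-- Build `X` up from `X ∩ M`, whose perp contains `M`. Each added point raises the rank by one and
lowers that of `M ∩ Q.perp Y` by at most one. -/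
theorem rank_add_rank_inter_le {M X : Set P} (hM : Q.IsSingular M) (hX : Q.IsSingular X) :
    Q.rank M + Q.rank (X ∩ M) ≤ Q.rank (M ∩ Q.perp X) + Q.rank X := by
  obtain ⟨Y, hY, ⟨hYX, hr⟩, hmax⟩ := h.exists_maximal_of
    (p := fun Y => Y ⊆ X ∧ Q.rank M + Q.rank (X ∩ M) ≤ Q.rank (M ∩ Q.perp Y) + Q.rank Y)
    ⟨X ∩ M, hX.inter_left hM.1, Set.inter_subset_left, by
      have hsub : M ⊆ Q.perp (X ∩ M) := fun y hy a ha => hM.2 y hy a ha.2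
      rw [Set.inter_eq_left.2 hsub]⟩
  by_cases hXY : X ⊆ Y
  · rwa [hYX.antisymm hXY] at hr
  obtain ⟨x, hx, hxY⟩ := Set.not_subset.1 hXY
  have hxp : x ∈ Q.perp Y := fun a ha => hX.2 x hx a (hYX ha)
  refine absurd (hmax _ (h.isSingular_span (hY.isClique.insert hxp)) ⟨?_, ?_⟩
    ((Set.subset_insert x Y).trans (subset_span _))) fun he => hxY ?_
  · exact span_subset hX.1 (Set.insert_subset hx hYX)
  · rw [h.rank_span_insert hY hxp hxY, h.perp_span_insert, ← Set.inter_assoc]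
    have := h.rank_le_rank_inter_perp_singleton (hM.inter_left (h.isSubspace_perp Y)) x
    omega
  · rw [← he]
    exact subset_span _ (Set.mem_insert x Y)

/-! ### Configurations of maximal singular subspaces -/

/-- Every singular subspace extends to a maximal one without enlarging its intersection with a
given maximal singular subspace. -/
theorem exists_maximal_inter_eq {N S : Set P} (hN : Maximal Q.IsSingular N)
    (hS : Q.IsSingular S) : ∃ M, Maximal Q.IsSingular M ∧ S ⊆ M ∧ M ∩ N = S ∩ N := by
  obtain ⟨M, hM, ⟨hSM, hMN⟩, hmax⟩ := h.exists_maximal_of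
    (p := fun M => S ⊆ M ∧ M ∩ N = S ∩ N) ⟨S, hS, subset_rfl, rfl⟩
  refine ⟨M, ?_, hSM, hMN⟩
  -- By exchange and the maximal choice of `M`, the span of this clique contains all of `Q.perp M`.
  -- So `Q.perp M` is a clique, whence it lies in `Q.perp (Q.perp M) = M`.
  have hc : Q.IsClique (M ∪ (N ∩ Q.perp M)) :=
    hM.isClique.union (hN.1.isClique.subset Set.inter_subset_left) Set.inter_subset_right
  have hT := h.isSingular_span hc
  have hsub : Q.perp M ⊆ Q.span (M ∪ (N ∩ Q.perp M)) := fun x hx => by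
    by_contra hxT
    have hxM : x ∉ M := fun hxM => hxT (subset_span _ (Or.inl hxM))
    have hins := hM.isClique.insert hx
    have hMins : M ⊆ Q.span (insert x M) := (Set.subset_insert x M).trans (subset_span _)
    have heq : Q.span (insert x M) ∩ N = S ∩ N := by
      rw [← hMN]
      refine subset_antisymm (fun y hy => ⟨?_, hy.2⟩) (Set.inter_subset_inter_left _ hMins)
      by_contra hyM
      refine hxT (span_mono ?_ (h.exchange hins hy.1 (by rwa [span_eq hM.1])))
      refine Set.insert_subset (Or.inr ⟨hy.2, fun a ha => ?_⟩) Set.subset_union_left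
      exact (h.isSingular_span hins).2 y hy.1 a (hMins ha)
    have := hmax _ (h.isSingular_span hins) ⟨hSM.trans hMins, heq⟩ hMins
    exact hxM (this ▸ subset_span _ (Set.mem_insert x M))
  refine maximal_of_perp_subset hM fun x hx => ?_
  have : x ∈ Q.perp (Q.perp M) := fun y hy => hT.2 x (hsub hx) y (hsub hy)
  rwa [← h.span_eq_perp_perp hM.2, span_eq hM.1] at this

/-- A maximal singular subspace meets the perp of an outside point in a hyperplane. -/
theorem rank_inter_perp_singleton {M : Set P} (hM : Maximal Q.IsSingular M) {x : P}
    (hx : x ∉ M) : Q.rank (M ∩ Q.perp {x}) + 1 = n := by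
  have h1 := h.rank_le_rank_inter_perp_singleton hM.1 x
  have h2 := h.rank_lt_of_ssubset (hM.1.inter_left (h.isSubspace_perp {x})) hM.1
    ⟨Set.inter_subset_left, fun hsub => hx ?_⟩
  · rw [h.rank_maximal hM] at h1 h2
    omega
  · rw [← h.perp_maximal hM]
    exact fun a ha => ((hsub ha).2 x rfl).symm

theorem maximal_span_insert {X : Set P} (hX : Q.IsSingular X) (hr : Q.rank X + 1 = n) {x : P}
    (hx : x ∈ Q.perp X) (hxX : x ∉ X) : Maximal Q.IsSingular (Q.span (insert x X)) := by
  rw [h.maximal_iff (h.isSingular_span (hX.isClique.insert hx)), h.rank_span_insert hX hx hxX, hr]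

/-- In a maximal singular subspace, a hyperplane containing `S` and missing `u`. -/
theorem exists_hyperplane {M S : Set P} (hM : Maximal Q.IsSingular M) (hS : Q.IsSingular S)
    (hSM : S ⊆ M) {u : P} (huM : u ∈ M) (hu : u ∉ S) :
    ∃ X, Q.IsSingular X ∧ Q.rank X + 1 = n ∧ S ⊆ X ∧ X ⊆ M ∧ u ∉ X := by
  obtain ⟨q, hq, huq⟩ := h.exists_mem_perp_not_coll hS hu
  refine ⟨M ∩ Q.perp {q}, hM.1.inter_left (h.isSubspace_perp _),
    h.rank_inter_perp_singleton hM fun hqM => huq (hM.1.2 u huM q hqM),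
    Set.subset_inter hSM ?_, Set.inter_subset_left, fun hmem => huq (hmem.2 q rfl)⟩
  rintro a ha b rfl
  exact (hq a ha).symm

/-- Any two distinct maximal singular subspaces are joined by moving through hyperplanes. -/
theorem exists_closer {M N : Set P} (hM : Maximal Q.IsSingular M) (hN : Maximal Q.IsSingular N)
    (hMN : M ≠ N) : ∃ M' X, Maximal Q.IsSingular M' ∧ Q.IsSingular X ∧ Q.rank X + 1 = n ∧
      X ⊆ M ∧ X ⊆ M' ∧ M ∩ N ⊆ X ∧ Q.rank (M ∩ N) < Q.rank (M' ∩ N) := by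
  obtain ⟨x, hxN, hxM⟩ : ∃ x ∈ N, x ∉ M :=
    Set.not_subset.1 fun hsub => hMN (eq_of_maximal_subset hN hM.1 hsub).symm
  have hX := hM.1.inter_left (h.isSubspace_perp {x})
  have hr := h.rank_inter_perp_singleton hM hxM
  have hxX : x ∈ Q.perp (M ∩ Q.perp {x}) := fun a ha => (ha.2 x rfl).symm
  have hM' := h.maximal_span_insert hX hr hxX fun hx => hxM hx.1
  have hXM' : M ∩ Q.perp {x} ⊆ Q.span (insert x (M ∩ Q.perp {x})) :=
    (Set.subset_insert _ _).trans (subset_span _)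
  have hsub : M ∩ N ⊆ M ∩ Q.perp {x} := by
    rintro a ⟨haM, haN⟩
    refine ⟨haM, ?_⟩
    rintro b rfl
    exact hN.1.2 a haN b hxN
  refine ⟨_, _, hM', hX, hr, Set.inter_subset_left, hXM', hsub,
    h.rank_lt_of_ssubset (hM.1.inter_left hN.1.1) (hM'.1.inter_left hN.1.1)
      ⟨Set.subset_inter (hsub.trans hXM') Set.inter_subset_right, fun hs => hxM (hs ⟨?_, hxN⟩).1⟩⟩
  exact subset_span _ (Set.mem_insert _ _)

/-- Intersecting with a hyperplane lowers the rank by at most one. -/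
theorem rank_le_rank_inter_hyperplane {M X S : Set P} (hM : Q.IsSingular M)
    (hX : Q.IsSingular X) (hr : Q.rank X + 1 = n) (hXM : X ⊆ M) (hS : Q.IsSingular S)
    (hSM : S ⊆ M) : Q.rank S ≤ Q.rank (S ∩ X) + 1 := by
  have h1 := h.rank_add_rank_le hS hX hM hSM hXM
  have h2 := h.rank_le hM
  omega

/-- Two distinct maximal singular subspaces through a common hyperplane meet in it. -/
theorem inter_eq_of_hyperplane {M N X : Set P} (hM : Maximal Q.IsSingular M)
    (hN : Maximal Q.IsSingular N) (hX : Q.IsSingular X) (hr : Q.rank X + 1 = n) (hXM : X ⊆ M)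
    (hXN : X ⊆ N) (hMN : M ≠ N) : M ∩ N = X := by
  have hMN' := hM.1.inter_left hN.1.1
  have hlt := h.rank_lt_of_ssubset hMN' hM.1 ⟨Set.inter_subset_left, fun hs =>
    hMN (eq_of_maximal_subset hM hN.1 (hs.trans Set.inter_subset_right))⟩
  rw [h.rank_maximal hM] at hlt
  exact (h.eq_of_subset_of_rank_le hX hMN' (Set.subset_inter hXM hXN) (by omega)).symm

/-- Every hyperplane lies in a maximal singular subspace that misses a given outside point. -/
theorem exists_maximal_superset_notMem {X : Set P} (hX : Q.IsSingular X) {p : P}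
    (hp : p ∉ X) : ∃ M, Maximal Q.IsSingular M ∧ X ⊆ M ∧ p ∉ M := by
  obtain ⟨q, hq, hpq⟩ := h.exists_mem_perp_not_coll hX hp
  obtain ⟨M, hM, hsub⟩ := h.exists_maximal_superset (hX.isClique.insert hq)
  exact ⟨M, hM, (Set.subset_insert _ _).trans hsub,
    fun hpM => hpq (hM.1.2 p hpM q (hsub (Set.mem_insert _ _)))⟩

end IsWeakPolarSpaceOfRank

namespace IsWeakPolarSpaceOfRank

variable (h : Q.IsWeakPolarSpaceOfRank n)
include h

/-! ### Distances in the Grassmann graph of hyperplanes -/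

theorem rank_vertex (X : Q.Grassmannian ((n : ℤ) - 2)) : Q.rank X.1 + 1 = n := by
  have := (h.hasDim_iff X.2.1).1 X.2.2
  omega

theorem hasDim_of_rank {X : Set P} (hX : Q.IsSingular X) (hr : Q.rank X + 1 = n) :
    Q.HasDim X ((n : ℤ) - 2) :=
  (h.hasDim_iff hX).2 (by omega)

theorem exists_maximal_of_adj {X Y : Q.Grassmannian ((n : ℤ) - 2)}
    (hXY : (Q.grassmannGraph ((n : ℤ) - 2)).Adj X Y) :
    ∃ M, Maximal Q.IsSingular M ∧ X.1 ⊆ M ∧ Y.1 ⊆ M := by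
  obtain ⟨-, U, hU, hd, hX, hY⟩ := hXY
  refine ⟨U, (h.maximal_iff hU).2 ?_, hX, hY⟩
  have := (h.hasDim_iff hU).1 hd
  omega

theorem edist_le_one {X Y : Q.Grassmannian ((n : ℤ) - 2)} {M : Set P}
    (hM : Maximal Q.IsSingular M) (hX : X.1 ⊆ M) (hY : Y.1 ⊆ M) :
    (Q.grassmannGraph ((n : ℤ) - 2)).edist X Y ≤ 1 := by
  rw [SimpleGraph.edist_le_one_iff_adj_or_eq]
  refine or_iff_not_imp_right.2 fun hne => ⟨hne, M, hM.1, ?_, hX, hY⟩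
  rw [h.hasDim_iff hM.1, h.rank_maximal hM]
  ring

theorem subset_perp_of_edist_le_one {X Y : Q.Grassmannian ((n : ℤ) - 2)}
    (hXY : (Q.grassmannGraph ((n : ℤ) - 2)).edist X Y ≤ 1) : Y.1 ⊆ Q.perp X.1 := by
  rcases SimpleGraph.edist_le_one_iff_adj_or_eq.1 hXY with hadj | rfl
  · obtain ⟨M, hM, hX, hY⟩ := h.exists_maximal_of_adj hadj
    exact fun y hy x hx => hM.1.2 y (hY hy) x (hX hx)
  · exact X.2.1.2

/-- Each move of `exists_closer` costs one edge and lowers the codimension of `M ∩ N`; one final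
edge joins two hyperplanes of the same maximal subspace. -/
theorem edist_le_of_le_rank_inter {M N : Set P} (hM : Maximal Q.IsSingular M)
    (hN : Maximal Q.IsSingular N) {X Y : Q.Grassmannian ((n : ℤ) - 2)} (hX : X.1 ⊆ M)
    (hY : Y.1 ⊆ N) {d : ℕ} (hd : n ≤ Q.rank (M ∩ N) + d) :
    (Q.grassmannGraph ((n : ℤ) - 2)).edist X Y ≤ (d + 1 : ℕ) := by
  induction d generalizing M X with
  | zero =>
    have : M ∩ N = M := h.eq_of_subset_of_rank_le (hM.1.inter_left hN.1.1) hM.1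
      Set.inter_subset_left (by rwa [h.rank_maximal hM])
    have hMN := eq_of_maximal_subset hM hN.1 (Set.inter_eq_left.1 this)
    exact_mod_cast h.edist_le_one hN (hMN ▸ hX) hY
  | succ d ih =>
    by_cases hMN : M = N
    · refine (h.edist_le_one hN (hMN ▸ hX) hY).trans ?_
      exact_mod_cast Nat.le_add_left 1 (d + 1)
    · obtain ⟨M', Z, hM', hZ, hr, hZM, hZM', -, hlt⟩ := h.exists_closer hM hN hMN
      have h1 := ih (X := ⟨Z, hZ, h.hasDim_of_rank hZ hr⟩) hM' hZM' (by omega)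
      have h2 := h.edist_le_one (X := X) (Y := ⟨Z, hZ, h.hasDim_of_rank hZ hr⟩) hM hX hZM
      refine (SimpleGraph.edist_triangle.trans (add_le_add h2 h1)).trans ?_
      push_cast
      rw [add_comm]

/-- Each edge lies in a maximal subspace. Subspaces of consecutive edges share a hyperplane, so an
extra edge costs at most one rank; the first edge costs nothing, hence the `n + 1`. -/
theorem exists_maximal_of_walk {X Y : Q.Grassmannian ((n : ℤ) - 2)}
    (w : (Q.grassmannGraph ((n : ℤ) - 2)).Walk X Y) (hw : w.length ≠ 0) :
    ∃ M N, Maximal Q.IsSingular M ∧ Maximal Q.IsSingular N ∧ X.1 ⊆ M ∧ Y.1 ⊆ N ∧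
      n + 1 ≤ Q.rank (M ∩ N) + w.length := by
  induction w with
  | nil => exact absurd rfl hw
  | @cons X Z Y hXZ w ih =>
    obtain ⟨M, hM, hXM, hZM⟩ := h.exists_maximal_of_adj hXZ
    rw [SimpleGraph.Walk.length_cons]
    by_cases hw0 : w.length = 0
    · obtain rfl := SimpleGraph.Walk.eq_of_length_eq_zero hw0
      refine ⟨M, M, hM, hM, hXM, hZM, ?_⟩
      rw [Set.inter_self, h.rank_maximal hM]
      omega
    · obtain ⟨M', N, hM', hN, hZM', hYN, hr⟩ := ih hw0
      refine ⟨M, N, hM, hN, hXM, hYN, ?_⟩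
      have h1 := h.rank_le_rank_inter_hyperplane hM'.1 Z.2.1 (h.rank_vertex Z) hZM'
        (hM'.1.inter_left hN.1.1) Set.inter_subset_left
      have h2 := h.rank_mono ((hM'.1.inter_left hN.1.1).inter_left Z.2.1.1)
        (hM.1.inter_left hN.1.1) fun x hx => ⟨hZM hx.2, hx.1.2⟩
      omega

theorem exists_maximal_of_edist_le {X Y : Q.Grassmannian ((n : ℤ) - 2)} (hXY : X ≠ Y) {k : ℕ}
    (hk : (Q.grassmannGraph ((n : ℤ) - 2)).edist X Y ≤ k) :
    ∃ M N, Maximal Q.IsSingular M ∧ Maximal Q.IsSingular N ∧ X.1 ⊆ M ∧ Y.1 ⊆ N ∧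
      n + 1 ≤ Q.rank (M ∩ N) + k := by
  obtain ⟨w, hw⟩ := SimpleGraph.exists_walk_of_edist_ne_top
    (ne_top_of_le_ne_top (ENat.natCast_ne_top k) hk)
  have hwk : w.length ≤ k := by exact_mod_cast hw.le.trans hk
  obtain ⟨M, N, hM, hN, hX, hY, hr⟩ := h.exists_maximal_of_walk w
    fun h0 => hXY (SimpleGraph.Walk.eq_of_length_eq_zero h0)
  exact ⟨M, N, hM, hN, hX, hY, by omega⟩

/-! ### More on hyperplanes -/

theorem mem_of_mem_perp_hyperplane {M X : Set P} (hM : Maximal Q.IsSingular M)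
    (hX : Q.IsSingular X) (hr : Q.rank X + 1 = n) (hXM : X ⊆ M) {p z : P} (hp : p ∈ M)
    (hpX : p ∉ X) (hz : z ∈ Q.perp X) (hzp : Q.Coll z p) : z ∈ M := by
  have hpp : p ∈ Q.perp X := fun a ha => hM.1.2 p hp a (hXM ha)
  have hspan : Q.span (insert p X) = M := eq_of_maximal_subset
    (h.maximal_span_insert hX hr hpp hpX) hM.1 (span_subset hM.1.1 (Set.insert_subset hp hXM))
  rw [← h.perp_maximal hM, ← hspan, h.perp_span]
  rintro a (rfl | ha)
  · exact hzp
  · exact hz a ha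

theorem exists_hyperplane_of_rank_lt {M S : Set P} (hM : Maximal Q.IsSingular M)
    (hS : Q.IsSingular S) (hSM : S ⊆ M) (hr : Q.rank S < n) :
    ∃ X, Q.IsSingular X ∧ Q.rank X + 1 = n ∧ S ⊆ X ∧ X ⊆ M := by
  have hne : ¬ M ⊆ S := fun hMS => by
    have := h.rank_mono hM.1 hS hMS
    rw [h.rank_maximal hM] at this
    omega
  obtain ⟨u, huM, huS⟩ := Set.not_subset.1 hne
  obtain ⟨X, hX, hrX, hSX, hXM, -⟩ := h.exists_hyperplane hM hS hSM huM huS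
  exact ⟨X, hX, hrX, hSX, hXM⟩

/-- A hyperplane of some maximal singular subspace through `S` and missing `p`. -/
theorem exists_vertex_notMem {S : Set P} (hS : Q.IsSingular S) (hr : Q.rank S < n) {p : P}
    (hp : p ∉ S) : ∃ X : Q.Grassmannian ((n : ℤ) - 2), S ⊆ X.1 ∧ p ∉ X.1 := by
  obtain ⟨M, hM, hSM, hpM⟩ := h.exists_maximal_superset_notMem hS hp
  obtain ⟨X, hX, hrX, hSX, hXM⟩ := h.exists_hyperplane_of_rank_lt hM hS hSM hr
  exact ⟨⟨X, hX, h.hasDim_of_rank hX hrX⟩, hSX, fun hpX => hpM (hXM hpX)⟩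

theorem rank_inter_lt {M N : Set P} (hM : Maximal Q.IsSingular M)
    (hN : Maximal Q.IsSingular N) (hMN : M ≠ N) : Q.rank (M ∩ N) < n := by
  rw [← h.rank_maximal hM]
  exact h.rank_lt_of_ssubset (hM.1.inter_left hN.1.1) hM.1 ⟨Set.inter_subset_left, fun hs =>
    hMN (eq_of_maximal_subset hM hN.1 (hs.trans Set.inter_subset_right))⟩

end IsWeakPolarSpaceOfRank

/-! ### The map on maximal singular subspaces -/

/-- `F` maps maximal singular subspaces to maximal singular subspaces compatibly with the map `f`
of their hyperplanes. -/
structure IsMaximalExtension (f : Q.Grassmannian ((n : ℤ) - 2) → Q'.Grassmannian ((n : ℤ) - 2))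
    (F : Set P → Set P') : Prop where
  maximal : ∀ {M}, Maximal Q.IsSingular M → Maximal Q'.IsSingular (F M)
  subset : ∀ {M}, Maximal Q.IsSingular M → ∀ {X : Q.Grassmannian ((n : ℤ) - 2)},
    X.1 ⊆ M → (f X).1 ⊆ F M

section

variable (h : Q.IsWeakPolarSpaceOfRank n) (h' : Q'.IsWeakPolarSpaceOfRank n)
  {f : Q.Grassmannian ((n : ℤ) - 2) → Q'.Grassmannian ((n : ℤ) - 2)}
  (hf : ∀ X Y, (Q'.grassmannGraph ((n : ℤ) - 2)).edist (f X) (f Y) =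
    (Q.grassmannGraph ((n : ℤ) - 2)).edist X Y)
include h h'

-- Adjacent or equal vertices have mutually collinear points, so the images of all hyperplanes of
-- `M` form a clique, which a maximal subspace contains.
include hf in
theorem exists_isMaximalExtension : ∃ F, IsMaximalExtension f F := by
  have key : ∀ M, Maximal Q.IsSingular M → ∃ M', Maximal Q'.IsSingular M' ∧
      ∀ X : Q.Grassmannian ((n : ℤ) - 2), X.1 ⊆ M → (f X).1 ⊆ M' := by
    intro M hM
    have hc : Q'.IsClique {p | ∃ X : Q.Grassmannian ((n : ℤ) - 2), X.1 ⊆ M ∧ p ∈ (f X).1} := by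
      rintro p ⟨X, hX, hp⟩ q ⟨Y, hY, hq⟩
      refine h'.subset_perp_of_edist_le_one (X := f Y) (Y := f X) ?_ hp q hq
      rw [hf]
      exact h.edist_le_one hM hY hX
    obtain ⟨M', hM', hsub⟩ := h'.exists_maximal_superset hc
    exact ⟨M', hM', fun X hX p hp => hsub ⟨X, hX, hp⟩⟩
  choose! F hF using key
  exact ⟨F, fun hM => (hF _ hM).1, fun hM X hX => (hF _ hM).2 X hX⟩

variable {F : Set P → Set P'} (hF : IsMaximalExtension f F)
include hF

/-- Move `M` towards `N` through hyperplanes `X`. The images of consecutive subspaces share `f X`,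
so the rank drops by at most one per step when going back. -/
theorem rank_inter_le_rank_map_inter {M N : Set P} (hM : Maximal Q.IsSingular M)
    (hN : Maximal Q.IsSingular N) : Q.rank (M ∩ N) ≤ Q'.rank (F M ∩ F N) := by
  suffices ∀ d M, Maximal Q.IsSingular M → n ≤ Q.rank (M ∩ N) + d →
      n ≤ Q'.rank (F M ∩ F N) + d by
    have h1 := h.rank_le (hM.1.inter_left hN.1.1)
    have := this (n - Q.rank (M ∩ N)) M hM (by omega)
    omega
  intro d
  induction d with
  | zero =>
    intro M hM hd
    have : M = N := by
      by_contra hMN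
      have := h.rank_inter_lt hM hN hMN
      omega
    rw [this, Set.inter_self, h'.rank_maximal (hF.maximal hN)]
    omega
  | succ d ih =>
    intro M hM hd
    by_cases hMN : M = N
    · rw [hMN, Set.inter_self, h'.rank_maximal (hF.maximal hN)]
      omega
    obtain ⟨M', Z, hM', hZ, hr, hZM, hZM', -, hlt⟩ := h.exists_closer hM hN hMN
    have h1 := ih M' hM' (by omega)
    set X : Q.Grassmannian ((n : ℤ) - 2) := ⟨Z, hZ, h.hasDim_of_rank hZ hr⟩
    have hs := (hF.maximal hM').1.inter_left (hF.maximal hN).1.1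
    have h2 := h'.rank_le_rank_inter_hyperplane (hF.maximal hM').1 (f X).2.1
      (h'.rank_vertex (f X)) (hF.subset hM' hZM') hs Set.inter_subset_left
    have h3 := h'.rank_mono (hs.inter_left (f X).2.1.1)
      ((hF.maximal hM).1.inter_left (hF.maximal hN).1.1)
      fun x hx => ⟨hF.subset hM (X := X) hZM hx.2, hx.1.2⟩
    omega

include hf

theorem rank_map_inter_le {M N : Set P} (hM : Maximal Q.IsSingular M)
    (hN : Maximal Q.IsSingular N) {p : P} (hpM : p ∈ M) (hpN : p ∈ N) :
    Q'.rank (F M ∩ F N) ≤ Q.rank (M ∩ N) := by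
  by_cases hMN : M = N
  · rw [hMN, Set.inter_self, Set.inter_self, h.rank_maximal hN, h'.rank_maximal (hF.maximal hN)]
  -- Both hyperplanes avoid the common point `p`. Isometry will give maximal `M₁ ⊇ X` and `N₁ ⊇ Y`
  -- meeting in rank at least that of `F M ∩ F N`.
  obtain ⟨X, hX, hrX, -, hXM, hpX⟩ := h.exists_hyperplane hM isSingular_empty
    (Set.empty_subset M) hpM (Set.notMem_empty p)
  obtain ⟨Y, hY, hrY, -, hYN, hpY⟩ := h.exists_hyperplane hN isSingular_empty
    (Set.empty_subset N) hpN (Set.notMem_empty p)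
  have hXY : X ≠ Y := by
    rintro rfl
    rw [← h.inter_eq_of_hyperplane hM hN hX hrX hXM hYN hMN] at hpX
    exact hpX ⟨hpM, hpN⟩
  set X₁ : Q.Grassmannian ((n : ℤ) - 2) := ⟨X, hX, h.hasDim_of_rank hX hrX⟩
  set Y₁ : Q.Grassmannian ((n : ℤ) - 2) := ⟨Y, hY, h.hasDim_of_rank hY hrY⟩
  have hle := h'.rank_le ((hF.maximal hM).1.inter_left (hF.maximal hN).1.1)
  have hd := h'.edist_le_of_le_rank_inter (hF.maximal hM) (hF.maximal hN)
    (hF.subset hM (X := X₁) hXM) (hF.subset hN (X := Y₁) hYN)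
    (d := n - Q'.rank (F M ∩ F N)) (by omega)
  rw [hf] at hd
  obtain ⟨M₁, N₁, hM₁, hN₁, hXM₁, hYN₁, hr⟩ := h.exists_maximal_of_edist_le
    (fun he => hXY (congrArg Subtype.val he)) hd
  have hMN₁ := hN₁.1.inter_left hM₁.1.1
  have h1 := h.rank_le_rank_inter_hyperplane hN₁.1 hY hrY hYN₁ hMN₁ Set.inter_subset_left
  have hI := hM.1.inter_left hN.1.1
  have h2 := h.rank_lt_of_ssubset (hMN₁.inter_left hY.1) hI ⟨?_, fun hs => hpY (hs ⟨hpM, hpN⟩).2⟩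
  · rw [Set.inter_comm] at hr
    omega
  -- Such a `z` is collinear to `X` and to `p`, which together span `M`. Hence `N₁ ∩ M₁ ∩ Y` lies in
  -- `M ∩ N` without containing `p`, and this strictness offsets the rank lost by cutting with `Y`.
  · rintro z ⟨⟨-, hzM₁⟩, hzY⟩
    exact ⟨h.mem_of_mem_perp_hyperplane hM hX hrX hXM hpM hpX
      (fun a ha => hM₁.1.2 z hzM₁ a (hXM₁ ha)) (hN.1.2 z (hYN hzY) p hpN), hYN hzY⟩

theorem map_inter_map_eq {M N : Set P} (hM : Maximal Q.IsSingular M)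
    (hN : Maximal Q.IsSingular N) (hMN : M ≠ N) {X : Q.Grassmannian ((n : ℤ) - 2)}
    (hXM : X.1 ⊆ M) (hXN : X.1 ⊆ N) : F M ∩ F N = (f X).1 := by
  refine h'.inter_eq_of_hyperplane (hF.maximal hM) (hF.maximal hN) (f X).2.1
    (h'.rank_vertex (f X)) (hF.subset hM hXM) (hF.subset hN hXN) fun he => ?_
  have hr := h.rank_vertex X
  have hn := h.two_le
  obtain ⟨p, hp⟩ := h.nonempty_of_rank_pos (by omega : 0 < Q.rank X.1)
  have h1 := rank_map_inter_le h h' hf hF hM hN (hXM hp) (hXN hp)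
  have h2 := h.rank_inter_lt hM hN hMN
  rw [he, Set.inter_self, h'.rank_maximal (hF.maximal hN)] at h1
  omega

/-! ### The map on points -/

/-- If `N` and `N'` meet only in `p`, then the image of any hyperplane of `N` through `p` contains
the common points of the images of `N` and `N'`. -/
theorem mem_map_of_opposite {N N' : Set P} (hN : Maximal Q.IsSingular N)
    (hN' : Maximal Q.IsSingular N') {p : P} (hpN : p ∈ N) (hpN' : p ∈ N')
    (hr : Q.rank (N ∩ N') ≤ 1) {p' : P'} (hp' : p' ∈ F N) (hp'' : p' ∈ F N')
    {X : Q.Grassmannian ((n : ℤ) - 2)} (hXN : X.1 ⊆ N) (hpX : p ∈ X.1) : p' ∈ (f X).1 := by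
  have hrX := h.rank_vertex X
  have h1 := h.rank_add_rank_inter_le hN'.1 X.2.1
  have h2 := h.one_le_rank (X.2.1.inter_left hN'.1.1) ⟨hpX, hpN'⟩
  rw [h.rank_maximal hN'] at h1
  -- The points of `N'` collinear to all of `X` have rank at least 2, so `F U ∩ F N'` has rank at
  -- least 2 and meets the hyperplane `f X` in a point, which must be `p'`.
  obtain ⟨U, hU, hXU⟩ := h.exists_maximal_superset (X.2.1.isClique.union
    (hN'.1.isClique.subset Set.inter_subset_left) (Set.inter_subset_right (s := N')))
  have h3 := h.rank_mono (hN'.1.inter_left (h.isSubspace_perp X.1)) (hU.1.inter_left hN'.1.1)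
    fun x hx => ⟨hXU (Or.inr hx), hx.1⟩
  have h4 := rank_inter_le_rank_map_inter h h' hF hU hN'
  have hs := (hF.maximal hU).1.inter_left (hF.maximal hN').1.1
  have h5 := h'.rank_le_rank_inter_hyperplane (hF.maximal hU).1 (f X).2.1 (h'.rank_vertex (f X))
    (hF.subset hU fun x hx => hXU (Or.inl hx)) hs Set.inter_subset_left
  obtain ⟨z, hz, hzX⟩ := h'.nonempty_of_rank_pos
    (by omega : 0 < Q'.rank (F U ∩ F N' ∩ (f X).1))
  have h6 := rank_map_inter_le h h' hf hF hN hN' hpN hpN'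
  rwa [h'.eq_of_rank_le_one ((hF.maximal hN).1.inter_left (hF.maximal hN').1.1) (h6.trans hr)
    ⟨hp', hp''⟩ ⟨hF.subset hN hXN hzX, hz.2⟩]

/-- The image of the star of a point consists of subspaces through a common point. -/
theorem exists_mem_map_of_mem (p : P) :
    ∃ p' : P', ∀ M, Maximal Q.IsSingular M → p ∈ M → p' ∈ F M := by
  obtain ⟨M, hM, hpM⟩ := h.exists_maximal_superset (isSingular_singleton (Q := Q) p).2
  rw [Set.singleton_subset_iff] at hpM
  obtain ⟨M', hM', hpM', hMM'⟩ := h.exists_maximal_inter_eq hM (isSingular_singleton p)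
  rw [Set.singleton_subset_iff] at hpM'
  rw [Set.inter_eq_left.2 (Set.singleton_subset_iff.2 hpM), Set.inter_comm] at hMM'
  have hr : Q.rank (M ∩ M') = 1 := by rw [hMM', h.rank_singleton]
  have hr' := rank_inter_le_rank_map_inter h h' hF hM hM'
  obtain ⟨p', hp'M, hp'M'⟩ := h'.nonempty_of_rank_pos (by omega : 0 < Q'.rank (F M ∩ F M'))
  refine ⟨p', ?_⟩
  -- The invariant carries an opposite partner `N'` along, since `mem_map_of_opposite` needs one at
  -- every step.
  let A : Set P → Prop := fun N => p ∈ N ∧ p' ∈ F N ∧ ∃ N', Maximal Q.IsSingular N' ∧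
    p ∈ N' ∧ p' ∈ F N' ∧ Q.rank (N ∩ N') ≤ 1
  have step : ∀ N K X, Maximal Q.IsSingular N → Maximal Q.IsSingular K → Q.IsSingular X →
      Q.rank X + 1 = n → X ⊆ N → X ⊆ K → p ∈ X → A N → A K := by
    rintro N K X hN hK hX hrX hXN hXK hpX ⟨hpN, hp'N, N', hN', hpN', hp'N', hr⟩
    have hp'X := mem_map_of_opposite h h' hf hF hN hN' hpN hpN' hr hp'N hp'N'
      (X := ⟨X, hX, h.hasDim_of_rank hX hrX⟩) hXN hpX
    refine ⟨hXK hpX, hF.subset hK hXK hp'X, ?_⟩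
    have hKN' := hK.1.inter_left hN'.1.1
    by_cases hle : Q.rank (K ∩ N') ≤ 1
    · exact ⟨N', hN', hpN', hp'N', hle⟩
    have h1 := h.rank_le_rank_inter_hyperplane hK.1 hX hrX hXK hKN' Set.inter_subset_left
    have h2 := h.rank_mono (hKN'.inter_left hX.1) (hN.1.inter_left hN'.1.1)
      fun x hx => ⟨hXN hx.2, hx.1.2⟩
    -- Here `K ∩ N'` has rank exactly 2. A new partner through a hyperplane of `N'` that contains
    -- `p` but misses `u` meets `K` in smaller rank.
    obtain ⟨u, ⟨huK, huN'⟩, hup⟩ := h.exists_ne_of_two_le_rank (not_le.1 hle) p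
    obtain ⟨X', hX', hrX', hpX', hX'N', huX'⟩ := h.exists_hyperplane hN' (isSingular_singleton p)
      (Set.singleton_subset_iff.2 hpN') huN' hup
    rw [Set.singleton_subset_iff] at hpX'
    obtain ⟨N'', hN'', hX'N'', hN''K⟩ := h.exists_maximal_inter_eq hK hX'
    rw [Set.inter_comm] at hr
    refine ⟨N'', hN'', hX'N'' hpX', hF.subset hN'' hX'N'' (mem_map_of_opposite h h' hf hF hN' hN
      hpN' hpN hr hp'N' hp'N (X := ⟨X', hX', h.hasDim_of_rank hX' hrX'⟩) hX'N' hpX'), ?_⟩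
    rw [Set.inter_comm, hN''K]
    have h3 := h.rank_lt_of_ssubset (hX'.inter_left hK.1.1) hKN'
      ⟨fun x hx => ⟨hx.2, hX'N' hx.1⟩, fun hs => huX' (hs ⟨huK, huN'⟩).1⟩
    rw [Set.inter_comm] at hr
    omega
  have connected : ∀ d N K, Maximal Q.IsSingular N → Maximal Q.IsSingular K → p ∈ K →
      n ≤ Q.rank (N ∩ K) + d → A N → A K := by
    intro d
    induction d with
    | zero =>
      intro N K hN hK hpK hd hA
      have : N = K := by
        by_contra hNK
        have := h.rank_inter_lt hN hK hNK
        omega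
      exact this ▸ hA
    | succ d ih =>
      intro N K hN hK hpK hd hA
      by_cases hNK : N = K
      · exact hNK ▸ hA
      obtain ⟨N₁, X, hN₁, hX, hrX, hXN, hXN₁, hsub, hlt⟩ := h.exists_closer hN hK hNK
      exact ih N₁ K hN₁ hK hpK (by omega)
        (step N N₁ X hN hN₁ hX hrX hXN hXN₁ (hsub ⟨hA.1, hpK⟩) hA)
  intro K hK hpK
  exact (connected n M K hM hK hpK (Nat.le_add_left _ _)
    ⟨hpM, hp'M, M', hM', hpM', hp'M', hr.le⟩).2.1

/-! ### Incidence and collinearity of image points -/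

variable {φ : P → P'} (hφ : ∀ p M, Maximal Q.IsSingular M → p ∈ M → φ p ∈ F M)
include hφ

/-- `X` lies in two distinct maximal subspaces, whose images meet exactly in `f X`. -/
theorem map_mem_of_mem {p : P} {X : Q.Grassmannian ((n : ℤ) - 2)} (hp : p ∈ X.1) :
    φ p ∈ (f X).1 := by
  obtain ⟨M, hM, hXM⟩ := h.exists_maximal_superset X.2.1.2
  have hne : ¬ M ⊆ X.1 := fun hs => by
    have h1 := h.rank_mono hM.1 X.2.1 hs
    have h2 := h.rank_vertex X
    rw [h.rank_maximal hM] at h1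
    omega
  obtain ⟨u, huM, huX⟩ := Set.not_subset.1 hne
  obtain ⟨N, hN, hXN, huN⟩ := h.exists_maximal_superset_notMem X.2.1 huX
  rw [← map_inter_map_eq h h' hf hF hM hN (by rintro rfl; exact huN huM) hXM hXN]
  exact ⟨hφ p M hM (hXM hp), hφ p N hN (hXN hp)⟩

/-- Some vertex `Y` through `p` contains no point collinear to all of `X`, which puts `X` and `Y` at
distance at least `n`. If `φ p` were in `f X`, then `f X` and `f Y` would share a point, and their
distance would be at most `n - 1`. -/
theorem map_notMem_of_notMem_perp {p : P} {X : Q.Grassmannian ((n : ℤ) - 2)}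
    (hp : p ∉ Q.perp X.1) : φ p ∉ (f X).1 := by
  intro hpf
  have hrX := h.rank_vertex X
  have hn := h.two_le
  obtain ⟨N, hN, hXN⟩ := h.exists_maximal_superset X.2.1.2
  have hpN : p ∉ N := fun hpN => hp fun a ha => hN.1.2 p hpN a (hXN ha)
  obtain ⟨M, hM, hpM, hMN⟩ := h.exists_maximal_inter_eq hN (isSingular_singleton p)
  rw [Set.singleton_subset_iff] at hpM
  have hempty : M ∩ N = ∅ := by
    rw [hMN, Set.singleton_inter_eq_empty.2 hpN]
  have hT := hM.1.inter_left (h.isSubspace_perp X.1)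
  obtain ⟨U, hU, hTU⟩ := h.exists_maximal_superset
    (X.2.1.isClique.union hT.isClique Set.inter_subset_right)
  have hrT := h.rank_add_rank_le hT X.2.1 hU.1 (fun x hx => hTU (Or.inr hx))
    fun x hx => hTU (Or.inl hx)
  have hTX : M ∩ Q.perp X.1 ∩ X.1 = ∅ :=
    Set.subset_empty_iff.1 (hempty ▸ fun x hx => ⟨hx.1.1, hXN hx.2⟩)
  rw [hTX, h.rank_empty, h.rank_maximal hU] at hrT
  -- `M ∩ Q.perp X.1` and `X` are disjoint inside the maximal `U`, so the former has rank at most 1.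
  -- A hyperplane of `M` missing `u` then avoids it.
  obtain ⟨u, huM, hup, huT⟩ : ∃ u ∈ M, u ≠ p ∧ ∀ t ∈ M ∩ Q.perp X.1, t = u := by
    by_cases hne : (M ∩ Q.perp X.1).Nonempty
    · obtain ⟨u, hu⟩ := hne
      exact ⟨u, hu.1, by rintro rfl; exact hp hu.2,
        fun t ht => h.eq_of_rank_le_one hT (by omega) ht hu⟩
    · obtain ⟨u, hu, hup⟩ := h.exists_ne_of_two_le_rank (by rwa [h.rank_maximal hM]) p
      exact ⟨u, hu, hup, fun t ht => absurd ⟨t, ht⟩ hne⟩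
  obtain ⟨Y, hY, hrY, hpY, hYM, huY⟩ := h.exists_hyperplane hM (isSingular_singleton p)
    (Set.singleton_subset_iff.2 hpM) huM hup
  rw [Set.singleton_subset_iff] at hpY
  set Y₁ : Q.Grassmannian ((n : ℤ) - 2) := ⟨Y, hY, h.hasDim_of_rank hY hrY⟩
  have hpfY : φ p ∈ (f Y₁).1 := map_mem_of_mem h h' hf hF hφ hpY
  obtain ⟨M', hM', hXM'⟩ := h'.exists_maximal_superset (f X).2.1.2
  have h1 := h'.rank_add_rank_inter_le hM'.1 (f Y₁).2.1
  have h2 := h'.one_le_rank ((f Y₁).2.1.inter_left hM'.1.1) ⟨hpfY, hXM' hpf⟩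
  have h3 := h'.rank_vertex (f Y₁)
  rw [h'.rank_maximal hM'] at h1
  obtain ⟨N', hN', hYN'⟩ := h'.exists_maximal_superset ((f Y₁).2.1.isClique.union
    (hM'.1.isClique.subset Set.inter_subset_left) (Set.inter_subset_right (s := M')))
  have h4 := h'.rank_mono (hM'.1.inter_left (h'.isSubspace_perp (f Y₁).1))
    (hM'.1.inter_left hN'.1.1) fun x hx => ⟨hx.1, hYN' (Or.inr hx)⟩
  have hd := h'.edist_le_of_le_rank_inter hM' hN' hXM' (fun x hx => hYN' (Or.inl hx))
    (X := f X) (Y := f Y₁) (d := n - 2) (by omega)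
  rw [hf] at hd
  have hXY : X ≠ Y₁ := fun he => hpN (hXN (by rw [he]; exact hpY))
  obtain ⟨M₁, N₁, hM₁, hN₁, hXM₁, hYN₁, hr⟩ := h.exists_maximal_of_edist_le hXY hd
  have hMN₁ := hN₁.1.inter_left hM₁.1.1
  have h5 := h.rank_le_rank_inter_hyperplane hN₁.1 hY hrY hYN₁ hMN₁ Set.inter_subset_left
  have h6 : N₁ ∩ M₁ ∩ Y = ∅ := by
    refine Set.eq_empty_of_forall_notMem fun z hz => huY ?_
    rw [← huT z ⟨hYM hz.2, fun a ha => hM₁.1.2 z hz.1.2 a (hXM₁ ha)⟩]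
    exact hz.2
  rw [h6, h.rank_empty] at h5
  rw [Set.inter_comm] at hr
  omega

theorem map_notMem_of_notMem (hinj : Function.Injective f) {p : P}
    {X : Q.Grassmannian ((n : ℤ) - 2)} (hp : p ∉ X.1) : φ p ∉ (f X).1 := by
  by_cases hpX : p ∉ Q.perp X.1
  · exact map_notMem_of_notMem_perp h h' hf hF hφ hpX
  rw [not_not] at hpX
  intro hpf
  have hn := h.two_le
  have hrX := h.rank_vertex X
  rcases hn.eq_or_lt with hn | hn
  -- In rank 2 the vertices are single points, so `f X = f Y` and injectivity of `f` applies.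
  · set Y : Q.Grassmannian ((n : ℤ) - 2) := ⟨{p}, isSingular_singleton p,
      h.hasDim_of_rank (isSingular_singleton p) ((h.rank_singleton p).symm ▸ hn)⟩
    have hpY : φ p ∈ (f Y).1 := map_mem_of_mem h h' hf hF hφ rfl
    have h1 := h'.rank_vertex (f X)
    have h2 := h'.rank_vertex (f Y)
    have heq : f X = f Y := Subtype.ext (subset_antisymm
      (fun z hz => by rwa [h'.eq_of_rank_le_one (f X).2.1 (by omega) hz hpf])
      (fun z hz => by rwa [h'.eq_of_rank_le_one (f Y).2.1 (by omega) hz hpY]))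
    rw [hinj heq] at hp
    exact hp rfl
  obtain ⟨M, hM, hXM, hpM⟩ := h.exists_maximal_superset_notMem X.2.1 hp
  -- Extend the line through `p` and `m` to a maximal `N` with `N ∩ M` of rank at most 1. Both image
  -- points lie in `F N ∩ F M`, which has rank at most 1 as well.
  have key : ∀ m ∈ X.1, φ m = φ p := by
    intro m hm
    have hpm : p ∈ Q.perp {m} := by
      rintro a rfl
      exact hpX a hm
    have hS := h.isSingular_span ((isSingular_singleton m).isClique.insert hpm)
    have hrS := h.rank_span_insert (isSingular_singleton m) hpm (by rintro rfl; exact hp hm)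
    rw [h.rank_singleton] at hrS
    have hmS : m ∈ Q.span {p, m} := subset_span _ (Or.inr rfl)
    have hpS : p ∈ Q.span {p, m} := subset_span _ (Or.inl rfl)
    obtain ⟨N, hN, hSN, hNM⟩ := h.exists_maximal_inter_eq hM hS
    have h1 := h.rank_lt_of_ssubset (hS.inter_left hM.1.1) hS
      ⟨Set.inter_subset_left, fun hs => hpM (hs hpS).2⟩
    have h2 := rank_map_inter_le h h' hf hF hN hM (hSN hmS) (hXM hm)
    rw [hNM] at h2
    exact h'.eq_of_rank_le_one ((hF.maximal hN).1.inter_left (hF.maximal hM).1.1) (by omega)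
      ⟨hφ m N hN (hSN hmS), hφ m M hM (hXM hm)⟩ ⟨hφ p N hN (hSN hpS), hF.subset hM hXM hpf⟩
  obtain ⟨a, ha⟩ := h.nonempty_of_rank_pos (by omega : 0 < Q.rank X.1)
  obtain ⟨b, hb, hba⟩ := h.exists_ne_of_two_le_rank (by omega : 2 ≤ Q.rank X.1) a
  -- A vertex through `a` and `c` contains a point not collinear to `b`, yet its image contains `φ a
  -- = φ b`. Such a vertex exists because `n ≥ 3` here.
  obtain ⟨c, hca, hbc⟩ := h.exists_mem_perp_not_coll (isSingular_singleton a) hba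
  have hS := h.isSingular_span ((isSingular_singleton a).isClique.insert hca)
  have hrS := h.rank_span_insert (isSingular_singleton a) hca
    (by rintro rfl; exact hbc (X.2.1.2 b hb c ha))
  rw [h.rank_singleton] at hrS
  obtain ⟨K, hK, hSK⟩ := h.exists_maximal_superset hS.2
  obtain ⟨Z, hZ, hrZ, hSZ, -⟩ := h.exists_hyperplane_of_rank_lt hK hS hSK (by omega)
  set Z₁ : Q.Grassmannian ((n : ℤ) - 2) := ⟨Z, hZ, h.hasDim_of_rank hZ hrZ⟩
  refine map_notMem_of_notMem_perp h h' hf hF hφ (p := b) (X := Z₁)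
    (fun hbZ => hbc (hbZ c (hSZ (subset_span _ (Or.inl rfl))))) ?_
  rw [key b hb, ← key a ha]
  exact map_mem_of_mem h h' hf hF hφ (hSZ (subset_span _ (Or.inr rfl)))

theorem isCollinearityPreservingInjection_map (hinj : Function.Injective f) :
    Q.IsCollinearityPreservingInjection Q' φ := by
  have hn := h.two_le
  refine ⟨fun p q hpq => ?_, fun p q => ⟨fun hc => ?_, fun hc => ?_⟩⟩
  · by_contra hne
    obtain ⟨X, hpX, hqX⟩ := h.exists_vertex_notMem (isSingular_singleton p)
      (by rw [h.rank_singleton]; omega) (Ne.symm hne : q ≠ p)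
    rw [Set.singleton_subset_iff] at hpX
    exact map_notMem_of_notMem h h' hf hF hφ hinj hqX (hpq ▸ map_mem_of_mem h h' hf hF hφ hpX)
  · by_contra hpq
    obtain ⟨M, hM, hpM⟩ := h.exists_maximal_superset (isSingular_singleton (Q := Q) p).2
    rw [Set.singleton_subset_iff] at hpM
    have hqM : q ∉ M := fun hqM => hpq (hM.1.2 p hpM q hqM)
    have hX := hM.1.inter_left (h.isSubspace_perp {q})
    have hrX := h.rank_inter_perp_singleton hM hqM
    have hqX : q ∈ Q.perp (M ∩ Q.perp {q}) := fun a ha => (ha.2 q rfl).symm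
    have hN := h.maximal_span_insert hX hrX hqX fun hq => hqM hq.1
    have hXN : M ∩ Q.perp {q} ⊆ Q.span (insert q (M ∩ Q.perp {q})) :=
      (Set.subset_insert _ _).trans (subset_span _)
    have hqN : q ∈ Q.span (insert q (M ∩ Q.perp {q})) := subset_span _ (Set.mem_insert _ _)
    -- If `φ p` and `φ q` are collinear, then `φ q` is collinear to `f X₁` and to `φ p`, which span
    -- `F M`. So `φ q` lies in `F M ∩ F N = f X₁`, although `q ∉ X₁`.
    set X₁ : Q.Grassmannian ((n : ℤ) - 2) := ⟨_, hX, h.hasDim_of_rank hX hrX⟩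
    have hp' : φ p ∉ (f X₁).1 := map_notMem_of_notMem h h' hf hF hφ hinj
      fun hp => hpq (hp.2 q rfl)
    have hq' : φ q ∉ (f X₁).1 := map_notMem_of_notMem h h' hf hF hφ hinj fun hq => hqM hq.1
    have hφq := hφ q _ hN hqN
    have hXM : X₁.1 ⊆ M := Set.inter_subset_left
    rw [← map_inter_map_eq h h' hf hF hM hN (fun he => hqM (he ▸ hqN)) (X := X₁)
      hXM hXN] at hq'
    refine hq' ⟨h'.mem_of_mem_perp_hyperplane (hF.maximal hM) (f X₁).2.1 (h'.rank_vertex (f X₁))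
      (hF.subset hM hXM) (hφ p M hM hpM) hp' (fun a ha => ?_) hc.symm, hφq⟩
    exact (hF.maximal hN).1.2 _ hφq a (hF.subset hN (X := X₁) hXN ha)
  · have hq : q ∈ Q.perp {p} := by
      rintro a rfl
      exact hc.symm
    obtain ⟨M, hM, hs⟩ := h.exists_maximal_superset ((isSingular_singleton p).isClique.insert hq)
    exact (hF.maximal hM).1.2 _ (hφ p M hM (hs (Or.inr rfl))) _ (hφ q M hM (hs (Or.inl rfl)))

/-- A basis of `X` has an independent image: for each basis point `x`, some vertex contains the
other basis points but not `x`, and its image separates `φ x` from their images. Comparing ranks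
finishes. -/
theorem span_image_eq (hinj : Function.Injective f) (X : Q.Grassmannian ((n : ℤ) - 2)) :
    (f X).1 = Q'.span (φ '' X.1) := by
  have hφinj := (isCollinearityPreservingInjection_map h h' hf hF hφ hinj).1
  have hsub : φ '' X.1 ⊆ (f X).1 := by
    rintro _ ⟨p, hp, rfl⟩
    exact map_mem_of_mem h h' hf hF hφ hp
  obtain ⟨I, hfin, hI, hs⟩ := h.exists_basis X.2.1
  have hIX : I ⊆ X.1 := hs ▸ subset_span I
  have hrX := h.rank_vertex X
  have hr' := h'.rank_vertex (f X)
  have hindep : Q'.Indep (φ '' I) := by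
    rintro _ ⟨x, hx, rfl⟩ hmem
    have hS := h.isSingular_span (X.2.1.isClique.subset (Set.sdiff_subset.trans hIX : I \ {x} ⊆ _))
    have hrS := h.rank_mono hS X.2.1 (hs ▸ span_mono Set.sdiff_subset)
    obtain ⟨Z, hSZ, hxZ⟩ := h.exists_vertex_notMem hS (by omega) (hI x hx)
    refine map_notMem_of_notMem h h' hf hF hφ hinj hxZ (span_subset (f Z).2.1.1 ?_ hmem)
    rintro _ ⟨⟨y, hy, rfl⟩, hyx⟩
    refine map_mem_of_mem h h' hf hF hφ (hSZ (subset_span _ ⟨hy, ?_⟩))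
    rintro rfl
    exact hyx rfl
  have hsub' := (Set.image_mono hIX).trans hsub
  have hT := h'.isSingular_span ((f X).2.1.isClique.subset hsub')
  have hrT := h'.rank_eq_ncard hT hindep rfl
  rw [Set.ncard_image_of_injective _ hφinj, ← h.rank_eq_ncard X.2.1 hI hs] at hrT
  have heq := h'.eq_of_subset_of_rank_le hT (f X).2.1 (span_subset (f X).2.1.1 hsub') (by omega)
  refine subset_antisymm ?_ (span_subset (f X).2.1.1 hsub)
  rw [← heq]
  exact span_mono (Set.image_mono hIX)

end

end PartialLinearSpace

theorem theorem3 {P : Type u} {P' : Type v} (Q : PartialLinearSpace P)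
    (Q' : PartialLinearSpace P') (n : ℕ)
    (hQ : Q.IsPolarSpaceOfRank n ∨ Q.IsThinPolarSpaceOfRank n)
    (hQ' : Q'.IsPolarSpaceOfRank n)
    (f : Q.grassmannGraph ((n : ℤ) - 2) ↪g Q'.grassmannGraph ((n : ℤ) - 2))
    (hf : f.IsIsometric) :
    ∃ φ : P → P', Q.IsCollinearityPreservingInjection Q' φ ∧
      ∀ S : Q.Grassmannian ((n : ℤ) - 2), (f S).1 = Q'.span (φ '' S.1) := by
  have h : Q.IsWeakPolarSpaceOfRank n :=
    hQ.elim (fun h => h.isWeakPolarSpaceOfRank) fun h => h.isWeakPolarSpaceOfRank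
  have h' := hQ'.isWeakPolarSpaceOfRank
  obtain ⟨F, hF⟩ := PartialLinearSpace.exists_isMaximalExtension h h' hf
  choose φ hφ using PartialLinearSpace.exists_mem_map_of_mem h h' hf hF
  exact ⟨φ, PartialLinearSpace.isCollinearityPreservingInjection_map h h' hf hF hφ f.injective,
    PartialLinearSpace.span_image_eq h h' hf hF hφ f.injective⟩
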